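/- Let $G=\mathrm{Isom}(\mathbb R^1_1)$ denote the simply connected three-dimensional Lie group of orientation- and time-orientation-preserving isometries of the Minkowski plane $\mathbb R^1_1$ (the identity component of its isometry group): in the global coordinates $(x,y,\theta)\in\mathbb R^3$ the element $(x,y,\theta)$ is the boost of rapidity $\theta$ followed by the translation by $(x,y)$. For a Riemannian metric $g$ on $G$ with Ricci tensor $R_{ij}$, scalar curvature $R$ and Levi-Civita connection $\nabla$, let $$C_{ij}=g_{ik}\,\varepsilon^{klm}\Bigl(\nabla_lR_{mj}-\tfrac14\nabla_lR\,g_{mj}\Bigr),\qquad \varepsilon^{klm}=\frac{\eta^{klm}}{\sqrt{\det g}},$$ be its Cotton–York tensor, where $\eta^{klm}$ is completely antisymmetric with $\eta^{123}=1$. For compact $K\subset G$ put $$C_K(g)=\int_K |C_2|_g\,d\mu_g,\qquad |C_2|_g^2=g^{ip}g^{jq}C_{ij}C_{pq}.$$ Let $g_0$ be any left-invariant Riemannian metric on $G$. Then there is a Ricci flow $\partial_t g=-2\,\mathrm{Ric}_{g}$, $t\in[0,\infty)$, of left-invariant metrics on $G$ with $g(0)=g_0$, and any Ricci flow of left-invariant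 metrics on an interval $[0,T)$ starting at $g_0$ coincides with it on $[0,T)$. For every compact set $K\subset G$, $$\lim_{t\to\infty}C_K(g(t))=0,$$ and if $K$ has positive measure, then $t\mapsto C_K(g(t))$ is strictly decreasing on $[0,\infty)$. -/

import Mathlib

open Set Filter Topology MeasureTheory
open scoped ContDiff

/-! ## The group `Isom(ℝ¹₁)` in global coordinates

`Isom(ℝ¹₁)` denotes the identity component (the simply connected three-dimensional group of proper
orthochronous isometries) of the isometry group of the Minkowski plane.  It is parametrised by
`(x, y, θ) ∈ ℝ³`: the boost of rapidity `θ` followed by the translation by `(x, y)`. -/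

namespace IsomMinkowski

/-- The Minkowski quadratic form on the plane. -/
def minkowskiForm (z : Fin 2 → ℝ) : ℝ := z 0 ^ 2 - z 1 ^ 2

/-- The isometry of the Minkowski plane with coordinates `p = (x, y, θ)`. -/
noncomputable def toIsom (p : Fin 3 → ℝ) (z : Fin 2 → ℝ) : Fin 2 → ℝ :=
  ![Real.cosh (p 2) * z 0 + Real.sinh (p 2) * z 1 + p 0,
    Real.sinh (p 2) * z 0 + Real.cosh (p 2) * z 1 + p 1]

/-- The group law of `Isom(ℝ¹₁)` in the coordinates `(x, y, θ)`; as a function of `q` it is the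
left translation by `p`. -/
noncomputable def mul (p q : Fin 3 → ℝ) : Fin 3 → ℝ :=
  ![Real.cosh (p 2) * q 0 + Real.sinh (p 2) * q 1 + p 0,
    Real.sinh (p 2) * q 0 + Real.cosh (p 2) * q 1 + p 1,
    p 2 + q 2]

/-- The group law is composition of isometries. -/
theorem toIsom_mul (p q : Fin 3 → ℝ) : toIsom (mul p q) = toIsom p ∘ toIsom q := by
  funext z
  ext i
  fin_cases i <;>
    simp [toIsom, mul, Real.cosh_add, Real.sinh_add] <;> ring

/-- The coordinates are faithful. -/
theorem toIsom_injective : Function.Injective toIsom := by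
  intro p q h
  have h0 := congrFun h 0
  have h1 := congrFun h ![1, 0]
  have e0 : p 0 = q 0 := by simpa [toIsom] using congrFun h0 0
  have e1 : p 1 = q 1 := by simpa [toIsom] using congrFun h0 1
  have e2 : p 2 = q 2 := by
    have := congrFun h1 1
    simpa [toIsom, e1] using this
  ext i
  fin_cases i <;> simp [e0, e1, e2]

/-- The coordinates describe exactly the maps of the Minkowski plane that preserve the Minkowski
form of differences, the orientation and the time orientation. -/
theorem range_toIsom :
    range toIsom = {f : (Fin 2 → ℝ) → (Fin 2 → ℝ) |
      (∀ z w, minkowskiForm (f z - f w) = minkowskiForm (z - w)) ∧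
      0 < (f ![1, 0] - f 0) 0 * (f ![0, 1] - f 0) 1 - (f ![0, 1] - f 0) 0 * (f ![1, 0] - f 0) 1 ∧
      0 < (f ![1, 0] - f 0) 0} := by
  ext f
  constructor
  · rintro ⟨p, rfl⟩
    have hcs := Real.cosh_sq (p 2)
    refine ⟨fun z w => ?_, ?_, ?_⟩
    · simp only [minkowskiForm, toIsom, Pi.sub_apply, Matrix.cons_val_zero, Matrix.cons_val_one]
      linear_combination ((z 0 - w 0) ^ 2 - (z 1 - w 1) ^ 2) * hcs
    · simp [toIsom]
      nlinarith [hcs]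
    · simpa [toIsom] using Real.cosh_pos (p 2)
  · rintro ⟨hQ, hdet, htime⟩
    set a := (f ![1, 0] - f 0) 0 with ha
    set c := (f ![1, 0] - f 0) 1 with hc
    set b := (f ![0, 1] - f 0) 0 with hb
    set d := (f ![0, 1] - f 0) 1 with hd
    have h1 : a ^ 2 - c ^ 2 = 1 := by
      have := hQ ![1, 0] 0
      simpa [minkowskiForm, ha, hc] using this
    have h2 : b ^ 2 - d ^ 2 = -1 := by
      have := hQ ![0, 1] 0
      simpa [minkowskiForm, hb, hd] using this
    have h3 : a * b = c * d := by
      have := hQ ![1, 0] ![0, 1]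
      simp only [minkowskiForm, Pi.sub_apply, Matrix.cons_val_zero, Matrix.cons_val_one] at this
      simp only [Pi.sub_apply] at ha hb hc hd
      have e1 : f ![1, 0] 0 - f ![0, 1] 0 = a - b := by rw [ha, hb]; ring
      have e2 : f ![1, 0] 1 - f ![0, 1] 1 = c - d := by rw [hc, hd]; ring
      rw [e1, e2] at this
      linear_combination (h1 + h2 - this) / 2
    have hD : a * d - b * c = 1 := by
      have : (a * d - b * c) ^ 2 = 1 := by
        linear_combination (-(b ^ 2 - d ^ 2)) * h1 - h2 + (a * b - c * d) * h3
      nlinarith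
    have hda : d = a := by linear_combination (-d) * h1 + a * hD + c * h3
    have hbc : b = c := by linear_combination (-b) * h1 + a * h3 + c * hD
    have hsinh : Real.sinh (Real.arsinh c) = c := Real.sinh_arsinh c
    have hcosh : Real.cosh (Real.arsinh c) = a := by
      rw [Real.cosh_arsinh, show 1 + c ^ 2 = a ^ 2 by linarith, Real.sqrt_sq htime.le]
    refine ⟨![f 0 0, f 0 1, Real.arsinh c], ?_⟩
    funext z
    have q0 := hQ z 0
    have q1 := hQ z ![1, 0]
    have q2 := hQ z ![0, 1]
    simp only [minkowskiForm, Pi.sub_apply, Matrix.cons_val_zero, Matrix.cons_val_one,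
      Pi.zero_apply, sub_zero] at q0 q1 q2
    simp only [Pi.sub_apply] at ha hb hc hd
    have r1 : a * (f z 0 - f 0 0) - c * (f z 1 - f 0 1) = z 0 := by
      rw [show f z 0 - f ![1, 0] 0 = (f z 0 - f 0 0) - a by rw [ha]; ring,
        show f z 1 - f ![1, 0] 1 = (f z 1 - f 0 1) - c by rw [hc]; ring] at q1
      linear_combination (q0 - q1 + h1) / 2
    have r2 : c * (f z 0 - f 0 0) - a * (f z 1 - f 0 1) = -z 1 := by
      rw [show f z 0 - f ![0, 1] 0 = (f z 0 - f 0 0) - b by rw [hb]; ring,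
        show f z 1 - f ![0, 1] 1 = (f z 1 - f 0 1) - d by rw [hd]; ring] at q2
      rw [hda, hbc] at q2
      linear_combination (q0 - q2 - h1) / 2
    ext i
    fin_cases i
    · simp [toIsom, hsinh, hcosh]
      linear_combination (f z 0 - f 0 0) * h1 - a * r1 + c * r2
    · simp [toIsom, hsinh, hcosh]
      linear_combination (f z 1 - f 0 1) * h1 - c * r1 + a * r2

end IsomMinkowski

/-! ## Riemannian geometry of `ℝ³` in global coordinates

A metric is given by its matrix of components `g x i j = g_{ij}(x)`. -/

namespace Riem3

/-- A smooth Riemannian metric on `ℝ³`. -/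
def IsMetric (g : (Fin 3 → ℝ) → Matrix (Fin 3) (Fin 3) ℝ) : Prop :=
  (∀ i j, ContDiff ℝ ∞ fun x => g x i j) ∧ ∀ x, (g x).PosDef

/-- The partial derivative `∂_i f`. -/
noncomputable def pd (i : Fin 3) (f : (Fin 3 → ℝ) → ℝ) (x : Fin 3 → ℝ) : ℝ :=
  fderiv ℝ f x (Pi.single i 1)

/-- The Christoffel symbol `Γ^k_{ij}` of the Levi-Civita connection. -/
noncomputable def christoffel (g : (Fin 3 → ℝ) → Matrix (Fin 3) (Fin 3) ℝ) (k i j : Fin 3)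
    (x : Fin 3 → ℝ) : ℝ :=
  (1 / 2) * ∑ l, (g x)⁻¹ k l *
    (pd i (fun y => g y j l) x + pd j (fun y => g y i l) x - pd l (fun y => g y i j) x)

/-- The component `R_{ijk}^l` of the curvature tensor, `R(∂_i, ∂_j) ∂_k = R_{ijk}^l ∂_l` with
`R(X, Y) = ∇_X ∇_Y - ∇_Y ∇_X - ∇_{[X, Y]}`. -/
noncomputable def curvature (g : (Fin 3 → ℝ) → Matrix (Fin 3) (Fin 3) ℝ) (i j k l : Fin 3)
    (x : Fin 3 → ℝ) : ℝ :=
  pd i (christoffel g l j k) x - pd j (christoffel g l i k) x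
    + ∑ m, (christoffel g l i m x * christoffel g m j k x
      - christoffel g l j m x * christoffel g m i k x)

/-- The Ricci tensor `R_{jk} = R_{ijk}^i`. -/
noncomputable def ricci (g : (Fin 3 → ℝ) → Matrix (Fin 3) (Fin 3) ℝ) (j k : Fin 3)
    (x : Fin 3 → ℝ) : ℝ :=
  ∑ i, curvature g i j k i x

/-- The scalar curvature. -/
noncomputable def scalar (g : (Fin 3 → ℝ) → Matrix (Fin 3) (Fin 3) ℝ) (x : Fin 3 → ℝ) : ℝ :=
  ∑ i, ∑ j, (g x)⁻¹ i j * ricci g i j x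

/-- The covariant derivative `∇_i R_{jk}` of the Ricci tensor. -/
noncomputable def covRicci (g : (Fin 3 → ℝ) → Matrix (Fin 3) (Fin 3) ℝ) (i j k : Fin 3)
    (x : Fin 3 → ℝ) : ℝ :=
  pd i (ricci g j k) x
    - ∑ m, (christoffel g m i j x * ricci g m k x + christoffel g m i k x * ricci g j m x)

/-- The completely antisymmetric symbol `η^{klm}` with `η^{012} = 1`. -/
noncomputable def eta (k l m : Fin 3) : ℝ :=
  (((l : ℕ) : ℝ) - ((k : ℕ) : ℝ)) * (((m : ℕ) : ℝ) - ((k : ℕ) : ℝ)) *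
    (((m : ℕ) : ℝ) - ((l : ℕ) : ℝ)) / 2

/-- The Cotton-York tensor
`C_{ij} = g_{ik} ε^{klm} (∇_l R_{mj} - (1/4) (∇_l R) g_{mj})`, `ε^{klm} = η^{klm} / √(det g)`. -/
noncomputable def cottonYork (g : (Fin 3 → ℝ) → Matrix (Fin 3) (Fin 3) ℝ) (i j : Fin 3)
    (x : Fin 3 → ℝ) : ℝ :=
  ∑ k, ∑ l, ∑ m, g x i k * (eta k l m / Real.sqrt (g x).det) *
    (covRicci g l m j x - (1 / 4) * pd l (scalar g) x * g x m j)

/-- The pointwise norm `|C₂|_g = (g^{ip} g^{jq} C_{ij} C_{pq})^{1/2}`. -/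
noncomputable def cottonYorkNorm (g : (Fin 3 → ℝ) → Matrix (Fin 3) (Fin 3) ℝ)
    (x : Fin 3 → ℝ) : ℝ :=
  Real.sqrt (∑ i, ∑ j, ∑ p, ∑ q,
    (g x)⁻¹ i p * (g x)⁻¹ j q * cottonYork g i j x * cottonYork g p q x)

/-- The `L¹`-norm `∫_K |C₂|_g dμ_g` with the Riemannian volume element `√(det g) dx`. -/
noncomputable def cottonYorkL1 (g : (Fin 3 → ℝ) → Matrix (Fin 3) (Fin 3) ℝ)
    (K : Set (Fin 3 → ℝ)) : ℝ :=
  ∫ x in K, cottonYorkNorm g x * Real.sqrt (g x).det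

/-- `g t`, `t ∈ I`, is a solution of the Ricci flow `∂g/∂t = -2 Ric_g`
(with the one-sided derivative at an end point of `I` that belongs to `I`). -/
def IsRicciFlowOn (I : Set ℝ) (g : ℝ → (Fin 3 → ℝ) → Matrix (Fin 3) (Fin 3) ℝ) : Prop :=
  (∀ t ∈ I, IsMetric (g t)) ∧
    ∀ t ∈ I, ∀ x i j, HasDerivWithinAt (fun s => g s x i j) (-2 * ricci (g t) i j x) I t

end Riem3

namespace IsomMinkowski

/-- The metric `g` on `Isom(ℝ¹₁)` is left-invariant: every left translation `L_p` is an isometry,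
`g_{L_p q}(dL_p v, dL_p w) = g_q(v, w)`. -/
def IsLeftInvariant (g : (Fin 3 → ℝ) → Matrix (Fin 3) (Fin 3) ℝ) : Prop :=
  ∀ p q v w : Fin 3 → ℝ,
    fderiv ℝ (mul p) q v ⬝ᵥ (g (mul p q)).mulVec (fderiv ℝ (mul p) q w) = v ⬝ᵥ (g q).mulVec w

/-- `g t`, `t ∈ I`, is a Ricci flow of left-invariant metrics on `Isom(ℝ¹₁)` starting at `g₀`. -/
def IsInvariantRicciFlow (I : Set ℝ) (g₀ : (Fin 3 → ℝ) → Matrix (Fin 3) (Fin 3) ℝ)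
    (g : ℝ → (Fin 3 → ℝ) → Matrix (Fin 3) (Fin 3) ℝ) : Prop :=
  Riem3.IsRicciFlowOn I g ∧ (∀ t ∈ I, IsLeftInvariant (g t)) ∧ g 0 = g₀

end IsomMinkowski

/-!
In the coordinates `(x, y, θ)` every left translation is affine, so partial differentiation maps
left-invariant tensors to left-invariant tensors, and the Christoffel symbols of a left-invariant
metric are themselves the components of a left-invariant tensor. In a left-invariant coframe all
curvature quantities are therefore computed by algebra with constant matrices.

Every left-invariant metric has a block-diagonal Gram matrix, with rows `(u, w, 0)`, `(w, v, 0)`,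
`(0, 0, s)`, in a suitable coframe `e^θ (dx - dy) + a dθ`, `e^{-θ} (dx + dy) + b dθ`, `dθ`. The
Ricci flow preserves `a`, `b`, `D = u v - w²`, `w s` and `u / v`, which reduces it to the single
equation `s' = 4 + 4 (w s)² / (D s²)`, whose solution increases from `s(0)` to infinity. The scalar
curvature is constant, the Cotton–York density is an explicit function of `D`, `w²` and `s`, and
along the flow `w = (w s) / s` turns it into a strictly decreasing function of `s` with limit zero.
-/

namespace Riem3

open scoped Matrix

section Partials

variable {S T : (Fin 3 → ℝ) → Matrix (Fin 3) (Fin 3) ℝ} {S' T' : Fin 3 → Matrix (Fin 3) (Fin 3) ℝ}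
  {x : Fin 3 → ℝ}

/-- The entries of the matrix field `T` are differentiable at `x`, and `T' i` is the matrix of their
`i`-th partial derivatives there. -/
def HasPartials (T : (Fin 3 → ℝ) → Matrix (Fin 3) (Fin 3) ℝ)
    (T' : Fin 3 → Matrix (Fin 3) (Fin 3) ℝ) (x : Fin 3 → ℝ) : Prop :=
  ∀ a b, DifferentiableAt ℝ (fun y => T y a b) x ∧ ∀ i, pd i (fun y => T y a b) x = T' i a b

theorem HasPartials.const (A : Matrix (Fin 3) (Fin 3) ℝ) : HasPartials (fun _ => A) 0 x :=
  fun a b => ⟨differentiableAt_const _, fun i => by simp [pd]⟩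

theorem HasPartials.transpose (hT : HasPartials T T' x) :
    HasPartials (fun y => (T y)ᵀ) (fun i => (T' i)ᵀ) x :=
  fun a b => hT b a

theorem HasPartials.mul (hS : HasPartials S S' x) (hT : HasPartials T T' x) :
    HasPartials (fun y => S y * T y) (fun i => S' i * T x + S x * T' i) x := by
  have hd : ∀ a b c, DifferentiableAt ℝ (fun y => S y a c * T y c b) x := fun a b c =>
    (hS a c).1.mul (hT c b).1
  refine fun a b => ⟨?_, fun i => ?_⟩
  · simpa only [Matrix.mul_apply] using DifferentiableAt.fun_sum fun c _ => hd a b c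
  · simp only [Matrix.mul_apply, Matrix.add_apply, pd, ← Finset.sum_add_distrib]
    rw [fderiv_fun_sum fun c _ => hd a b c, sum_apply]
    refine Finset.sum_congr rfl fun c _ => ?_
    rw [fderiv_fun_mul (hS a c).1 (hT c b).1, ← (hS a c).2 i, ← (hT c b).2 i]
    simp only [add_apply, smul_apply, smul_eq_mul, pd]
    ring

/-- The coordinate components of a matrix-valued one-form with components `T b` in the coframe
`e`, whose `b`-th covector is the `b`-th row of `e`. -/
def pull (e : Matrix (Fin 3) (Fin 3) ℝ) (T : Fin 3 → Matrix (Fin 3) (Fin 3) ℝ) (i : Fin 3) :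
    Matrix (Fin 3) (Fin 3) ℝ :=
  ∑ b, e b i • T b

theorem HasPartials.pull (hT : HasPartials T T' x) (A : Fin 3 → Matrix (Fin 3) (Fin 3) ℝ)
    (j : Fin 3) :
    HasPartials (fun y => Riem3.pull (T y) A j) (fun i => Riem3.pull (T' i) A j) x := by
  have hd : ∀ a b c, DifferentiableAt ℝ (fun y => T y c j * A c a b) x := fun a b c =>
    (hT c j).1.mul_const _
  refine fun a b => ⟨?_, fun i => ?_⟩
  · simpa only [Riem3.pull, Matrix.sum_apply, Matrix.smul_apply, smul_eq_mul] using
      DifferentiableAt.fun_sum fun c _ => hd a b c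
  · simp only [Riem3.pull, Matrix.sum_apply, Matrix.smul_apply, smul_eq_mul, pd]
    rw [fderiv_fun_sum fun c _ => hd a b c, sum_apply]
    refine Finset.sum_congr rfl fun c _ => ?_
    rw [fderiv_mul_const (hT c j).1, ← (hT c j).2 i]
    simp only [smul_apply, smul_eq_mul, pd]
    ring

end Partials

section Christoffel

variable {g : (Fin 3 → ℝ) → Matrix (Fin 3) (Fin 3) ℝ} {x : Fin 3 → ℝ}

theorem christoffel_eq_of_isSymm_of_hasPartials {Γ : Fin 3 → Matrix (Fin 3) (Fin 3) ℝ}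
    (hg : (g x).IsSymm) (hdet : IsUnit (g x).det) (htorsion : ∀ i j k, Γ i k j = Γ j k i)
    (hcompat : HasPartials g (fun i => (Γ i)ᵀ * g x + g x * Γ i) x) (k i j : Fin 3) :
    christoffel g k i j x = Γ i k j := by
  have hlower : ∀ l, pd i (fun y => g y j l) x + pd j (fun y => g y i l) x
      - pd l (fun y => g y i j) x = 2 * (g x * Γ i) l j := by
    intro l
    simp only [(hcompat _ _).2, Matrix.add_apply, Matrix.mul_apply, Matrix.transpose_apply,
      Finset.mul_sum, ← Finset.sum_add_distrib, ← Finset.sum_sub_distrib]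
    refine Finset.sum_congr rfl fun b _ => ?_
    rw [htorsion j i b, htorsion l i b, htorsion l j b, hg.apply b l, hg.apply b j]
    ring
  calc christoffel g k i j x = ((g x)⁻¹ * (g x * Γ i)) k j := by
        simp only [christoffel, hlower, Matrix.mul_apply (M := (g x)⁻¹), Finset.mul_sum]
        exact Finset.sum_congr rfl fun l _ => by ring
    _ = Γ i k j := by rw [Matrix.nonsing_inv_mul_cancel_left _ _ hdet]

end Christoffel

section Pull

variable (e : Matrix (Fin 3) (Fin 3) ℝ)

theorem pull_add (A B : Fin 3 → Matrix (Fin 3) (Fin 3) ℝ) (i : Fin 3) :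
    pull e (A + B) i = pull e A i + pull e B i := by
  simp only [pull, Pi.add_apply, smul_add, Finset.sum_add_distrib]

theorem pull_sub (A B : Fin 3 → Matrix (Fin 3) (Fin 3) ℝ) (i : Fin 3) :
    pull e (A - B) i = pull e A i - pull e B i := by
  simp only [pull, Pi.sub_apply, smul_sub, Finset.sum_sub_distrib]

theorem pull_apply_apply (A : Fin 3 → Matrix (Fin 3) (Fin 3) ℝ) (i a b : Fin 3) :
    pull e A i a b = ∑ c, e c i * A c a b := by
  simp only [pull, Matrix.sum_apply, Matrix.smul_apply, smul_eq_mul]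

theorem transpose_pull (A : Fin 3 → Matrix (Fin 3) (Fin 3) ℝ) (i : Fin 3) :
    (pull e A i)ᵀ = pull e (fun b => (A b)ᵀ) i := by
  simp only [pull, Matrix.transpose_sum, Matrix.transpose_smul]

theorem pull_mul (A : Fin 3 → Matrix (Fin 3) (Fin 3) ℝ) (B : Matrix (Fin 3) (Fin 3) ℝ) (i : Fin 3) :
    pull e A i * B = pull e (fun b => A b * B) i := by
  simp only [pull, Finset.sum_mul, smul_mul_assoc]

theorem mul_pull (A : Matrix (Fin 3) (Fin 3) ℝ) (B : Fin 3 → Matrix (Fin 3) (Fin 3) ℝ) (i : Fin 3) :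
    A * pull e B i = pull e (fun b => A * B b) i := by
  simp only [pull, Finset.mul_sum, mul_smul_comm]

/-- The coordinate components of a matrix-valued bilinear form with components `T b c` in the
coframe `e`. -/
def pull₂ (T : Fin 3 → Fin 3 → Matrix (Fin 3) (Fin 3) ℝ) (i j : Fin 3) :
    Matrix (Fin 3) (Fin 3) ℝ :=
  pull e (fun b => pull e (T b) j) i

theorem pull₂_add (S T : Fin 3 → Fin 3 → Matrix (Fin 3) (Fin 3) ℝ) (i j : Fin 3) :
    pull₂ e (S + T) i j = pull₂ e S i j + pull₂ e T i j :=
  (congrArg (pull e · i) (funext fun b => pull_add e (S b) (T b) j)).trans (pull_add e _ _ i)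

theorem pull₂_sub (S T : Fin 3 → Fin 3 → Matrix (Fin 3) (Fin 3) ℝ) (i j : Fin 3) :
    pull₂ e (S - T) i j = pull₂ e S i j - pull₂ e T i j :=
  (congrArg (pull e · i) (funext fun b => pull_sub e (S b) (T b) j)).trans (pull_sub e _ _ i)

theorem pull₂_swap (T : Fin 3 → Fin 3 → Matrix (Fin 3) (Fin 3) ℝ) (i j : Fin 3) :
    pull₂ e (fun b c => T c b) i j = pull₂ e T j i := by
  simp only [pull₂, pull, Finset.smul_sum]
  rw [Finset.sum_comm]
  exact Finset.sum_congr rfl fun _ _ => Finset.sum_congr rfl fun _ _ => smul_comm ..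

theorem pull_mul_pull (A B : Fin 3 → Matrix (Fin 3) (Fin 3) ℝ) (i j : Fin 3) :
    pull e A i * pull e B j = pull₂ e (fun b c => A b * B c) i j := by
  rw [pull₂, pull_mul]
  simp only [mul_pull]

theorem pull_pull_mul (K A : Fin 3 → Matrix (Fin 3) (Fin 3) ℝ) (i j : Fin 3) :
    pull (pull e K i * e) A j = pull₂ e (fun b c => ∑ d, K b d c • A d) i j := by
  ext p q
  simp only [pull₂, pull_apply_apply, Matrix.mul_apply, Matrix.sum_apply, Matrix.smul_apply,
    smul_eq_mul, Finset.mul_sum, Finset.sum_mul]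
  rw [Finset.sum_comm_cycle]
  refine Finset.sum_congr rfl fun b _ => ?_
  rw [Finset.sum_comm]
  exact Finset.sum_congr rfl fun c _ => Finset.sum_congr rfl fun d _ => by ring

end Pull

section Coframe

/-- The rows of `E x` form a coframe with dual frame the columns of `F x`, and the partial
derivatives of both have constant components `K` in the coframe; `flat` says that the partial
derivatives of `E` commute. A left-invariant coframe of a Lie group is of this kind in coordinates
in which the left translations are affine. -/
structure IsInvariantCoframe (E F : (Fin 3 → ℝ) → Matrix (Fin 3) (Fin 3) ℝ)
    (K : Fin 3 → Matrix (Fin 3) (Fin 3) ℝ) : Prop where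
  mul_frame : ∀ x, E x * F x = 1
  hasPartials_coframe : ∀ x, HasPartials E (fun i => pull (E x) K i * E x) x
  hasPartials_frame : ∀ x, HasPartials F (fun i => -(F x * pull (E x) K i)) x
  flat : ∀ c d, K c * K d - K d * K c = ∑ b, (K c b d - K d b c) • K b

/-- `Γ b` is the matrix of the covariant derivative along the `b`-th frame vector, acting on frame
components, of the Levi-Civita connection of the metric with Gram matrix `M`, for an invariant
coframe with constants `K`. -/
structure IsLeviCivita (M : Matrix (Fin 3) (Fin 3) ℝ) (K Γ : Fin 3 → Matrix (Fin 3) (Fin 3) ℝ) :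
    Prop where
  isSymm : M.IsSymm
  isUnit_det : IsUnit M.det
  skew : ∀ b, (Γ b)ᵀ * M + M * Γ b = 0
  torsion_free : ∀ a b c, (Γ + K) b a c = (Γ + K) c a b

/-- The covariant two-tensor field with constant components `A` in the coframe `E`. -/
def ofCoframe (E : (Fin 3 → ℝ) → Matrix (Fin 3) (Fin 3) ℝ) (A : Matrix (Fin 3) (Fin 3) ℝ)
    (x : Fin 3 → ℝ) : Matrix (Fin 3) (Fin 3) ℝ :=
  (E x)ᵀ * A * E x

/-- The curvature endomorphism `R(e_b, e_c)` in a frame with connection matrices `Γ`. -/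
def frameCurvature (Γ : Fin 3 → Matrix (Fin 3) (Fin 3) ℝ) (b c : Fin 3) :
    Matrix (Fin 3) (Fin 3) ℝ :=
  Γ b * Γ c - Γ c * Γ b - ∑ d, (Γ b d c - Γ c d b) • Γ d

/-- The Ricci tensor in a frame with connection matrices `Γ`. -/
def frameRicci (Γ : Fin 3 → Matrix (Fin 3) (Fin 3) ℝ) : Matrix (Fin 3) (Fin 3) ℝ :=
  Matrix.of fun c d => ∑ b, frameCurvature Γ b c b d

/-- The covariant derivative `∇_b Ric` in a frame with connection matrices `Γ`. -/
def frameCovRicci (Γ : Fin 3 → Matrix (Fin 3) (Fin 3) ℝ) (b : Fin 3) :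
    Matrix (Fin 3) (Fin 3) ℝ :=
  -((Γ b)ᵀ * frameRicci Γ + frameRicci Γ * Γ b)

variable {E F : (Fin 3 → ℝ) → Matrix (Fin 3) (Fin 3) ℝ} {K Γ : Fin 3 → Matrix (Fin 3) (Fin 3) ℝ}
  {M : Matrix (Fin 3) (Fin 3) ℝ} {x : Fin 3 → ℝ}

theorem det_ofCoframe (E : (Fin 3 → ℝ) → Matrix (Fin 3) (Fin 3) ℝ)
    (A : Matrix (Fin 3) (Fin 3) ℝ) (x : Fin 3 → ℝ) :
    (ofCoframe E A x).det = (E x).det ^ 2 * A.det := by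
  rw [ofCoframe, Matrix.det_mul, Matrix.det_mul, Matrix.det_transpose]
  ring

/- The right-hand side lists, with `Γ + K` the Christoffel symbols, the terms of the coordinate
formula for the curvature: the derivatives of the coframe and of the frame contribute the terms
with `K`. -/
theorem frameCurvature_eq (hflat : ∀ c d, K c * K d - K d * K c = ∑ b, (K c b d - K d b c) • K b)
    (htorsion : ∀ a b c, (Γ + K) b a c = (Γ + K) c a b) :
    frameCurvature Γ = (fun c d => ∑ b, K c b d • (Γ + K) b) - (fun c d => ∑ b, K d b c • (Γ + K) b)
      + (fun c d => (Γ + K) d * K c) - (fun c d => K c * (Γ + K) d)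
      + (fun c d => K d * (Γ + K) c) - (fun c d => (Γ + K) c * K d)
      + (fun c d => (Γ + K) c * (Γ + K) d) - (fun c d => (Γ + K) d * (Γ + K) c) := by
  funext c d
  have hK : ∀ b, K c b d - K d b c = -(Γ c b d - Γ d b c) := fun b => by
    have := htorsion b c d
    simp only [Pi.add_apply, Matrix.add_apply] at this
    linarith
  have hsum : ∑ b, K c b d • (Γ + K) b - ∑ b, K d b c • (Γ + K) b =
      K c * K d - K d * K c - ∑ b, (Γ c b d - Γ d b c) • Γ b := by
    rw [hflat, ← Finset.sum_sub_distrib, ← Finset.sum_sub_distrib]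
    refine Finset.sum_congr rfl fun b _ => ?_
    rw [← sub_smul, hK, Pi.add_apply, smul_add, neg_smul, neg_smul]
    abel
  simp only [Pi.sub_apply, Pi.add_apply, frameCurvature] at hsum ⊢
  rw [hsum]
  noncomm_ring

namespace IsInvariantCoframe

variable (hE : IsInvariantCoframe E F K)
include hE

theorem frame_mul (x : Fin 3 → ℝ) : F x * E x = 1 :=
  mul_eq_one_comm.1 (hE.mul_frame x)

theorem isUnit_det (x : Fin 3 → ℝ) : IsUnit (E x).det :=
  Matrix.isUnit_det_of_right_inverse (hE.mul_frame x)

theorem inv_ofCoframe (A : Matrix (Fin 3) (Fin 3) ℝ) (x : Fin 3 → ℝ) :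
    (ofCoframe E A x)⁻¹ = F x * A⁻¹ * (F x)ᵀ := by
  rw [ofCoframe, Matrix.mul_inv_rev, Matrix.mul_inv_rev, ← Matrix.transpose_nonsing_inv,
    Matrix.inv_eq_right_inv (hE.mul_frame x), mul_assoc]

theorem hasPartials_ofCoframe (A : Matrix (Fin 3) (Fin 3) ℝ) (x : Fin 3 → ℝ) :
    HasPartials (ofCoframe E A) (fun i =>
      (E x)ᵀ * ((pull (E x) K i)ᵀ * A + A * pull (E x) K i) * E x) x := by
  have h : HasPartials (ofCoframe E A) _ x :=
    ((hE.hasPartials_coframe x).transpose.mul (.const A)).mul (hE.hasPartials_coframe x)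
  convert h using 2 with i
  simp only [Matrix.transpose_mul, Pi.zero_apply, Matrix.mul_zero]
  noncomm_ring

theorem hasPartials_connection (A : Fin 3 → Matrix (Fin 3) (Fin 3) ℝ) (j : Fin 3)
    (x : Fin 3 → ℝ) :
    HasPartials (fun y => F y * pull (E y) A j * E y) (fun i =>
      F x * (pull (pull (E x) K i * E x) A j + pull (E x) A j * pull (E x) K i
        - pull (E x) K i * pull (E x) A j) * E x) x := by
  have h := ((hE.hasPartials_frame x).mul ((hE.hasPartials_coframe x).pull A j)).mul
    (hE.hasPartials_coframe x)
  convert h using 2 with i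
  noncomm_ring

theorem christoffel_ofCoframe (hΓ : IsLeviCivita M K Γ) (k i j : Fin 3) :
    christoffel (ofCoframe E M) k i j = fun x => (F x * pull (E x) (Γ + K) i * E x) k j := by
  funext x
  refine christoffel_eq_of_isSymm_of_hasPartials
    (Γ := fun i => F x * pull (E x) (Γ + K) i * E x) ?_ ?_ ?_ ?_ k i j
  · simp only [Matrix.IsSymm, ofCoframe, Matrix.transpose_mul, Matrix.transpose_transpose,
      hΓ.isSymm.eq, mul_assoc]
  · rw [det_ofCoframe]
    exact ((hE.isUnit_det x).pow 2).mul hΓ.isUnit_det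
  · intro i j k
    have hsymm : ∀ a, (pull (E x) (Γ + K) i * E x) a j = (pull (E x) (Γ + K) j * E x) a i := by
      intro a
      simp only [Matrix.mul_apply, pull_apply_apply, Finset.sum_mul]
      rw [Finset.sum_comm]
      refine Finset.sum_congr rfl fun b _ => Finset.sum_congr rfl fun c _ => ?_
      rw [hΓ.torsion_free a c b]
      ring
    simp only [mul_assoc, Matrix.mul_apply (M := F x), hsymm]
  · have hskew : ∀ i, (pull (E x) Γ i)ᵀ * M + M * pull (E x) Γ i = 0 := fun i => by
      rw [transpose_pull, pull_mul, mul_pull, ← pull_add]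
      simp only [pull, Pi.add_apply, hΓ.skew, smul_zero, Finset.sum_const_zero]
    convert hE.hasPartials_ofCoframe M x using 2 with i
    calc _ = (E x)ᵀ * (pull (E x) (Γ + K) i)ᵀ * (E x * F x)ᵀ * M * E x
          + (E x)ᵀ * M * (E x * F x) * pull (E x) (Γ + K) i * E x := by
          simp only [ofCoframe, Matrix.transpose_mul, mul_assoc]
      _ = (E x)ᵀ * ((pull (E x) Γ i)ᵀ * M + M * pull (E x) Γ i) * E x
          + (E x)ᵀ * ((pull (E x) K i)ᵀ * M + M * pull (E x) K i) * E x := by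
          rw [hE.mul_frame, Matrix.transpose_one, pull_add, Matrix.transpose_add]
          noncomm_ring
      _ = _ := by rw [hskew, mul_zero, zero_mul, zero_add]

theorem curvature_ofCoframe (hΓ : IsLeviCivita M K Γ) (i j k l : Fin 3) (x : Fin 3 → ℝ) :
    curvature (ofCoframe E M) i j k l x =
      (F x * pull₂ (E x) (frameCurvature Γ) i j * E x) l k := by
  set G : Fin 3 → Matrix (Fin 3) (Fin 3) ℝ := fun i => F x * pull (E x) (Γ + K) i * E x with hG
  have hpd := fun i j => (hE.hasPartials_connection (Γ + K) j x l k).2 i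
  have hmul : ∀ i j, G i * G j =
      F x * (pull (E x) (Γ + K) i * pull (E x) (Γ + K) j) * E x := fun i j => by
    calc G i * G j = F x * pull (E x) (Γ + K) i * (E x * F x) * pull (E x) (Γ + K) j * E x := by
          simp only [hG, mul_assoc]
      _ = _ := by rw [hE.mul_frame]; simp only [mul_one, mul_assoc]
  simp only [curvature, hE.christoffel_ofCoframe hΓ, hpd, Finset.sum_sub_distrib]
  simp only [← Matrix.mul_apply, ← Matrix.sub_apply, ← Matrix.add_apply]
  change (_ + (G i * G j - G j * G i)) l k = _
  rw [hmul, hmul, frameCurvature_eq hE.flat hΓ.torsion_free]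
  simp only [pull₂_add, pull₂_sub, pull_pull_mul, pull_mul_pull]
  rw [pull₂_swap _ (fun c d => ∑ b, K c b d • (Γ + K) b), pull₂_swap _ (fun c d => (Γ + K) c * K d),
    pull₂_swap _ (fun c d => K c * (Γ + K) d), pull₂_swap _ (fun c d => (Γ + K) c * (Γ + K) d)]
  refine congrArg (fun A : Matrix (Fin 3) (Fin 3) ℝ => A l k) ?_
  noncomm_ring

theorem sum_frame_mul_pull (T : Fin 3 → Matrix (Fin 3) (Fin 3) ℝ) (q : Fin 3) (x : Fin 3 → ℝ) :
    ∑ i, (F x * pull (E x) T i) i q = ∑ b, T b b q := by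
  calc ∑ i, (F x * pull (E x) T i) i q = ∑ b, ∑ p, (E x * F x) b p * T b p q := by
        simp only [Matrix.mul_apply, pull_apply_apply, Finset.mul_sum, Finset.sum_mul]
        rw [Finset.sum_comm_cycle]
        exact Finset.sum_congr rfl fun _ _ => Finset.sum_comm.trans <|
          Finset.sum_congr rfl fun _ _ => Finset.sum_congr rfl fun _ _ => by ring
    _ = ∑ b, T b b q := by
        simp only [hE.mul_frame, Matrix.one_apply, ite_mul, one_mul, zero_mul, Finset.sum_ite_eq,
          Finset.mem_univ, if_true]

theorem ricci_ofCoframe (hΓ : IsLeviCivita M K Γ) (j k : Fin 3) :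
    ricci (ofCoframe E M) j k = fun x => ofCoframe E (frameRicci Γ) x j k := by
  funext x
  calc ∑ i, curvature (ofCoframe E M) i j k i x
      = ∑ q, (∑ i, (F x * pull₂ (E x) (frameCurvature Γ) i j) i q) * E x q k := by
        simp only [hE.curvature_ofCoframe hΓ, Matrix.mul_apply (N := E x), Finset.sum_mul]
        exact Finset.sum_comm
    _ = ∑ q, (∑ b, ∑ c, E x c j * frameCurvature Γ b c b q) * E x q k := by
        simp only [pull₂, hE.sum_frame_mul_pull, pull_apply_apply]
    _ = ofCoframe E (frameRicci Γ) x j k := by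
        simp only [ofCoframe, frameRicci, Matrix.mul_apply, Matrix.transpose_apply,
          Matrix.of_apply, Finset.mul_sum]
        exact Finset.sum_congr rfl fun _ _ => congrArg (· * _) Finset.sum_comm

theorem scalar_ofCoframe (hΓ : IsLeviCivita M K Γ) :
    scalar (ofCoframe E M) = fun _ => (M⁻¹ * (frameRicci Γ)ᵀ).trace := by
  funext x
  calc ∑ i, ∑ j, (ofCoframe E M x)⁻¹ i j * ricci (ofCoframe E M) i j x
      = ((F x * M⁻¹ * (F x)ᵀ) * (ofCoframe E (frameRicci Γ) x)ᵀ).trace := by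
        simp only [hE.inv_ofCoframe, hE.ricci_ofCoframe hΓ, Matrix.trace, Matrix.diag_apply,
          Matrix.mul_apply (N := (ofCoframe E (frameRicci Γ) x)ᵀ), Matrix.transpose_apply]
    _ = (F x * (M⁻¹ * (E x * F x)ᵀ * (frameRicci Γ)ᵀ) * E x).trace := by
        simp only [ofCoframe, Matrix.transpose_mul, Matrix.transpose_transpose, mul_assoc]
    _ = (M⁻¹ * (frameRicci Γ)ᵀ).trace := by
        rw [Matrix.trace_mul_comm, ← mul_assoc, hE.mul_frame, Matrix.transpose_one, mul_one,
          one_mul]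

theorem covRicci_ofCoframe (hΓ : IsLeviCivita M K Γ) (k i j : Fin 3) (x : Fin 3 → ℝ) :
    covRicci (ofCoframe E M) k i j x =
      ((E x)ᵀ * pull (E x) (frameCovRicci Γ) k * E x) i j := by
  set R := frameRicci Γ with hR
  set P := F x * pull (E x) (Γ + K) k * E x with hP
  have hcov : pull (E x) (frameCovRicci Γ) k =
      (pull (E x) K k)ᵀ * R + R * pull (E x) K k
        - ((pull (E x) (Γ + K) k)ᵀ * R + R * pull (E x) (Γ + K) k) := by
    simp only [transpose_pull, pull_mul, mul_pull, ← pull_add, ← pull_sub]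
    congr 1
    funext b
    simp only [frameCovRicci, Pi.add_apply, Pi.sub_apply, Matrix.transpose_add]
    noncomm_ring
  have hPR : Pᵀ * ofCoframe E R x + ofCoframe E R x * P =
      (E x)ᵀ * ((pull (E x) (Γ + K) k)ᵀ * R + R * pull (E x) (Γ + K) k) * E x := by
    calc _ = (E x)ᵀ * (pull (E x) (Γ + K) k)ᵀ * (E x * F x)ᵀ * R * E x
          + (E x)ᵀ * R * (E x * F x) * pull (E x) (Γ + K) k * E x := by
          simp only [hP, ofCoframe, Matrix.transpose_mul, mul_assoc]
      _ = _ := by rw [hE.mul_frame, Matrix.transpose_one]; noncomm_ring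
  calc covRicci (ofCoframe E M) k i j x
      = ((E x)ᵀ * ((pull (E x) K k)ᵀ * R + R * pull (E x) K k) * E x) i j
        - (Pᵀ * ofCoframe E R x + ofCoframe E R x * P) i j := by
        simp only [covRicci, hE.ricci_ofCoframe hΓ, hE.christoffel_ofCoframe hΓ,
          (hE.hasPartials_ofCoframe R x _ _).2, ← hR, ← hP, Matrix.add_apply,
          Finset.sum_add_distrib, Matrix.mul_apply (N := P), Matrix.mul_apply (M := Pᵀ),
          Matrix.transpose_apply, mul_comm (P _ j)]
    _ = _ := by rw [hPR, hcov, ← Matrix.sub_apply, mul_sub, sub_mul]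

end IsInvariantCoframe

end Coframe

section Curl

/-- The skew matrix `η^{k··}`. -/
noncomputable def etaMatrix (k : Fin 3) : Matrix (Fin 3) (Fin 3) ℝ :=
  Matrix.of (eta k)

/-- The curl `η^{abc} T_{bcd}` of a tensor whose first two indices are contracted with `η`. -/
noncomputable def curl (T : Fin 3 → Matrix (Fin 3) (Fin 3) ℝ) : Matrix (Fin 3) (Fin 3) ℝ :=
  Matrix.of fun a d => ∑ b, (etaMatrix a * T b) b d

variable {e f : Matrix (Fin 3) (Fin 3) ℝ}

theorem sum_smul_conj_etaMatrix (e : Matrix (Fin 3) (Fin 3) ℝ) (a : Fin 3) :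
    ∑ k, e a k • (e * etaMatrix k * eᵀ) = e.det • etaMatrix a := by
  ext b c
  simp only [Matrix.sum_apply, Matrix.smul_apply, Matrix.mul_apply, Matrix.transpose_apply,
    smul_eq_mul, Fin.sum_univ_three, Matrix.det_fin_three, etaMatrix, Matrix.of_apply, eta]
  fin_cases a <;> fin_cases b <;> fin_cases c <;> simp <;> ring

theorem conj_etaMatrix (hef : e * f = 1) (k : Fin 3) :
    e * etaMatrix k * eᵀ = e.det • ∑ a, f k a • etaMatrix a := by
  have hfe : ∀ l, ∑ a, f k a * e a l = (1 : Matrix (Fin 3) (Fin 3) ℝ) k l := fun l => by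
    rw [← mul_eq_one_comm.1 hef, Matrix.mul_apply]
  calc e * etaMatrix k * eᵀ = ∑ l, (∑ a, f k a * e a l) • (e * etaMatrix l * eᵀ) := by
        simp only [hfe, Matrix.one_apply, ite_smul, one_smul, zero_smul, Finset.sum_ite_eq,
          Finset.mem_univ, if_true]
    _ = ∑ a, f k a • ∑ l, e a l • (e * etaMatrix l * eᵀ) := by
        simp only [Finset.sum_smul, Finset.smul_sum, smul_smul]
        exact Finset.sum_comm
    _ = e.det • ∑ a, f k a • etaMatrix a := by
        simp only [sum_smul_conj_etaMatrix, Finset.smul_sum, smul_comm e.det]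

theorem curl_conj_pull (hef : e * f = 1) (T : Fin 3 → Matrix (Fin 3) (Fin 3) ℝ) :
    curl (fun l => eᵀ * pull e T l * e) = e.det • (f * curl T * e) := by
  ext k j
  calc ∑ l, (etaMatrix k * (eᵀ * pull e T l * e)) l j
      = ∑ b, ((e * etaMatrix k * eᵀ) * (T b * e)) b j := by
        simp only [mul_pull, pull_mul, pull_apply_apply]
        rw [Finset.sum_comm]
        simp only [mul_assoc, Matrix.mul_apply (M := e)]
    _ = e.det * ∑ b, ∑ a, f k a * (etaMatrix a * T b * e) b j := by
        simp only [conj_etaMatrix hef, smul_mul_assoc, Finset.sum_mul, Matrix.smul_apply,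
          Matrix.sum_apply, smul_eq_mul, Finset.mul_sum, mul_assoc]
    _ = e.det * (f * (curl T * e)) k j := by
        rw [Finset.sum_comm]
        simp only [Matrix.mul_apply (M := f), Matrix.mul_apply (N := e), curl, Matrix.of_apply,
          Finset.sum_mul, Finset.mul_sum]
        exact Finset.sum_congr rfl fun _ _ => Finset.sum_comm
    _ = (e.det • (f * curl T * e)) k j := by
        rw [Matrix.smul_apply, smul_eq_mul, mul_assoc]

end Curl

section Cotton

theorem cottonYork_of_scalar_const {g : (Fin 3 → ℝ) → Matrix (Fin 3) (Fin 3) ℝ} {c : ℝ}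
    (hc : scalar g = fun _ => c) (i j : Fin 3) (x : Fin 3 → ℝ) :
    cottonYork g i j x = (√(g x).det)⁻¹ *
      (g x * curl (fun l => Matrix.of fun m j => covRicci g l m j x)) i j := by
  have hpd : ∀ l, pd l (scalar g) x = 0 := fun l => by simp [hc, pd]
  simp only [cottonYork, hpd, mul_zero, zero_mul, sub_zero, curl, etaMatrix, Matrix.mul_apply,
    Matrix.of_apply, Finset.mul_sum]
  exact Finset.sum_congr rfl fun _ _ => Finset.sum_congr rfl fun _ _ =>
    Finset.sum_congr rfl fun _ _ => by ring

theorem sum_mul_mul_mul_eq_trace (A C : Matrix (Fin 3) (Fin 3) ℝ) :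
    ∑ i, ∑ j, ∑ p, ∑ q, A i p * A j q * C i j * C p q = (A * C * Aᵀ * Cᵀ).trace := by
  simp only [Matrix.trace, Matrix.diag_apply, Matrix.mul_apply, Matrix.transpose_apply,
    Finset.sum_mul]
  refine Finset.sum_congr rfl fun i _ => Finset.sum_congr rfl fun j _ => ?_
  rw [Finset.sum_comm]
  exact Finset.sum_congr rfl fun q _ => Finset.sum_congr rfl fun p _ => by ring

variable {E F : (Fin 3 → ℝ) → Matrix (Fin 3) (Fin 3) ℝ} {K Γ : Fin 3 → Matrix (Fin 3) (Fin 3) ℝ}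
  {M : Matrix (Fin 3) (Fin 3) ℝ} {x : Fin 3 → ℝ}

theorem IsInvariantCoframe.cottonYork_ofCoframe (hE : IsInvariantCoframe E F K)
    (hΓ : IsLeviCivita M K Γ) (i j : Fin 3) (x : Fin 3 → ℝ) :
    cottonYork (ofCoframe E M) i j x = ((E x).det / √(ofCoframe E M x).det) *
      ofCoframe E (M * curl (frameCovRicci Γ)) x i j := by
  rw [cottonYork_of_scalar_const (hE.scalar_ofCoframe hΓ)]
  have hcurl : curl (fun l => Matrix.of fun m j => covRicci (ofCoframe E M) l m j x) =
      (E x).det • (F x * curl (frameCovRicci Γ) * E x) := by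
    rw [← curl_conj_pull (hE.mul_frame x)]
    simp only [hE.covRicci_ofCoframe hΓ]
    rfl
  have hmul : ofCoframe E M x * (F x * curl (frameCovRicci Γ) * E x) =
      ofCoframe E (M * curl (frameCovRicci Γ)) x := by
    calc _ = (E x)ᵀ * M * (E x * F x) * curl (frameCovRicci Γ) * E x := by
          simp only [ofCoframe, mul_assoc]
      _ = _ := by rw [hE.mul_frame]; simp only [ofCoframe, mul_one, mul_assoc]
  rw [hcurl, mul_smul_comm, hmul, Matrix.smul_apply, smul_eq_mul]
  ring

theorem IsInvariantCoframe.trace_ofCoframe (hE : IsInvariantCoframe E F K)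
    (A M : Matrix (Fin 3) (Fin 3) ℝ) (x : Fin 3 → ℝ) :
    ((ofCoframe E M x)⁻¹ * ofCoframe E A x * ((ofCoframe E M x)⁻¹)ᵀ * (ofCoframe E A x)ᵀ).trace =
      (M⁻¹ * A * (M⁻¹)ᵀ * Aᵀ).trace := by
  rw [hE.inv_ofCoframe]
  calc _ = (F x * (M⁻¹ * (E x * F x)ᵀ * A * (E x * F x) * (M⁻¹)ᵀ * (E x * F x)ᵀ * Aᵀ)
        * E x).trace := by
        simp only [ofCoframe, Matrix.transpose_mul, Matrix.transpose_transpose, mul_assoc]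
    _ = _ := by
        rw [Matrix.trace_mul_comm, ← mul_assoc, hE.mul_frame, Matrix.transpose_one]
        simp only [mul_one, one_mul]

theorem IsInvariantCoframe.cottonYorkNorm_mul_sqrt_det (hE : IsInvariantCoframe E F K)
    (hΓ : IsLeviCivita M K Γ) (hM : 0 < M.det) (x : Fin 3 → ℝ) :
    cottonYorkNorm (ofCoframe E M) x * √(ofCoframe E M x).det =
      √((E x).det ^ 2 *
        (curl (frameCovRicci Γ) * M⁻¹ * (curl (frameCovRicci Γ))ᵀ * M).trace) := by
  set Y := curl (frameCovRicci Γ)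
  set d := (ofCoframe E M x).det with hd
  have hd0 : 0 < d := by
    have := (hE.isUnit_det x).ne_zero
    rw [hd, det_ofCoframe]
    positivity
  set κ := (E x).det / √d with hκ
  have hC : (Matrix.of fun i j => cottonYork (ofCoframe E M) i j x) =
      κ • ofCoframe E (M * Y) x := by
    ext i j
    exact hE.cottonYork_ofCoframe hΓ i j x
  have htrace : ∑ i, ∑ j, ∑ p, ∑ q, (ofCoframe E M x)⁻¹ i p * (ofCoframe E M x)⁻¹ j q *
      cottonYork (ofCoframe E M) i j x * cottonYork (ofCoframe E M) p q x =
      κ ^ 2 * (Y * M⁻¹ * Yᵀ * M).trace := by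
    have h := sum_mul_mul_mul_eq_trace (ofCoframe E M x)⁻¹
      (Matrix.of fun i j => cottonYork (ofCoframe E M) i j x)
    simp only [Matrix.of_apply] at h
    rw [h, hC]
    simp only [Matrix.transpose_smul, mul_smul_comm, smul_mul_assoc, smul_smul, Matrix.trace_smul,
      smul_eq_mul]
    rw [hE.trace_ofCoframe, Matrix.transpose_mul, Matrix.transpose_nonsing_inv, hΓ.isSymm.eq,
      ← mul_assoc, ← mul_assoc, Matrix.nonsing_inv_mul _ hΓ.isUnit_det, one_mul, sq]
  rw [cottonYorkNorm, htrace, ← Real.sqrt_mul' _ hd0.le, hκ, div_pow, Real.sq_sqrt hd0.le]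
  congr 1
  field_simp

end Cotton

section AutonomousODE

variable {I : Set ℝ} {t₀ t : ℝ}

theorem eq_of_hasDerivWithinAt_zero {f : ℝ → ℝ} (hI : Convex ℝ I)
    (hf : ∀ t ∈ I, HasDerivWithinAt f 0 I t) (ht₀ : t₀ ∈ I) (ht : t ∈ I) : f t = f t₀ := by
  have := hI.norm_image_sub_le_of_norm_hasDerivWithin_le (C := 0) hf (by simp) ht₀ ht
  rwa [zero_mul, norm_le_zero_iff, sub_eq_zero] at this

theorem surjective_of_le_deriv {F F' : ℝ → ℝ} {c : ℝ} (hF : ∀ y, HasDerivAt F (F' y) y)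
    (hc : 0 < c) (hF' : ∀ y, c ≤ F' y) : Function.Surjective F := by
  have hmono : Monotone fun y => F y - c * y :=
    monotone_of_hasDerivAt_nonneg
      (fun y => (hF y).sub (((hasDerivAt_id y).const_mul c).congr_deriv (mul_one c)))
      fun y => sub_nonneg.2 (hF' y)
  have hcont : Continuous F := continuous_iff_continuousAt.2 fun y => (hF y).continuousAt
  refine hcont.surjective ?_ ?_
  · refine tendsto_atTop_mono' _ (f₁ := fun y => c * y + F 0) ?_
      (tendsto_atTop_add_const_right _ (F 0) (tendsto_id.const_mul_atTop hc))
    filter_upwards [eventually_ge_atTop 0] with y hy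
    linarith [(hmono hy : _ - c * _ ≤ _ - c * _)]
  · refine tendsto_atBot_mono' _ (f₁ := fun y => c * y + F 0) ?_
      (tendsto_atBot_add_const_right _ (F 0) (tendsto_id.const_mul_atBot hc))
    filter_upwards [eventually_le_atBot 0] with y hy
    linarith [(hmono hy : _ - c * _ ≤ _ - c * _)]

variable {f : ℝ → ℝ}

theorem exists_orderIso_hasDerivAt {C : ℝ} (hf : Continuous f) (hpos : ∀ y, 0 < f y)
    (hC : ∀ y, f y ≤ C) (y₀ : ℝ) : ∃ σ : ℝ ≃o ℝ, σ 0 = y₀ ∧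
      (∀ t, HasDerivAt σ (f (σ t)) t) ∧ ∀ y, HasDerivAt σ.symm (f y)⁻¹ y := by
  let F : ℝ → ℝ := fun y => ∫ x in y₀..y, (f x)⁻¹
  have hinv : Continuous fun y => (f y)⁻¹ := hf.inv₀ fun y => (hpos y).ne'
  have hF : ∀ y, HasDerivAt F (f y)⁻¹ y := fun y => intervalIntegral.integral_hasDerivAt_right
    (hinv.intervalIntegrable _ _) (hinv.stronglyMeasurableAtFilter _ _) hinv.continuousAt
  have hmono : StrictMono F := strictMono_of_hasDerivAt_pos hF fun y => inv_pos.2 (hpos y)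
  have hsurj : Function.Surjective F :=
    surjective_of_le_deriv hF (inv_pos.2 ((hpos 0).trans_le (hC 0)))
      fun y => inv_anti₀ (hpos y) (hC y)
  let σ : ℝ ≃o ℝ := (hmono.orderIsoOfSurjective F hsurj).symm
  refine ⟨σ, ?_, fun t => ?_, hF⟩
  · rw [← σ.apply_symm_apply y₀]
    exact congrArg σ intervalIntegral.integral_same.symm
  · simpa only [inv_inv] using HasDerivAt.of_local_left_inverse σ.continuous.continuousAt (hF (σ t))
      (inv_ne_zero (hpos _).ne') (.of_forall σ.symm_apply_apply)

theorem eq_orderIso_of_hasDerivWithinAt {σ : ℝ ≃o ℝ} {y : ℝ → ℝ} (hf : ∀ t ∈ I, f (y t) ≠ 0)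
    (hσ : ∀ y, HasDerivAt σ.symm (f y)⁻¹ y) (hI : Convex ℝ I)
    (hy : ∀ t ∈ I, HasDerivWithinAt y (f (y t)) I t) (ht₀ : t₀ ∈ I) (h₀ : y t₀ = σ t₀)
    (ht : t ∈ I) : y t = σ t := by
  have hconst := eq_of_hasDerivWithinAt_zero (f := fun t => σ.symm (y t) - t) hI (fun t ht =>
    (((hσ (y t)).comp_hasDerivWithinAt t (hy t ht)).sub (hasDerivWithinAt_id t I)).congr_deriv
      (by rw [inv_mul_cancel₀ (hf t ht), sub_self])) ht₀ ht
  simp only [h₀, σ.symm_apply_apply, sub_self, sub_eq_zero] at hconst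
  rw [← hconst, σ.apply_symm_apply, hconst]

end AutonomousODE

end Riem3

namespace IsomMinkowski

open Riem3
open scoped Matrix

section LeftInvariance

/-- The matrix of the differential of a left translation of rapidity `θ`. -/
noncomputable def boost (θ : ℝ) : Matrix (Fin 3) (Fin 3) ℝ :=
  !![Real.cosh θ, Real.sinh θ, 0; Real.sinh θ, Real.cosh θ, 0; 0, 0, 1]

theorem boost_mul_boost_neg (θ : ℝ) : boost θ * boost (-θ) = 1 := by
  have := Real.cosh_sq_sub_sinh_sq θ
  ext i j
  fin_cases i <;> fin_cases j <;> simp [boost, Matrix.mul_apply, Fin.sum_univ_three] <;> linarith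

theorem mul_eq_boost_mulVec_add (p q : Fin 3 → ℝ) : mul p q = boost (p 2) *ᵥ q + p := by
  ext i
  fin_cases i <;> simp [mul, boost, dotProduct, Fin.sum_univ_three, add_comm]

theorem fderiv_mul (p q v : Fin 3 → ℝ) : fderiv ℝ (mul p) q v = boost (p 2) *ᵥ v := by
  have h : HasFDerivAt (mul p) (boost (p 2)).mulVecLin.toContinuousLinearMap q := by
    rw [funext (mul_eq_boost_mulVec_add p)]
    exact (boost (p 2)).mulVecLin.toContinuousLinearMap.hasFDerivAt.add_const p
  rw [h.fderiv]
  rfl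

theorem isLeftInvariant_iff {g : (Fin 3 → ℝ) → Matrix (Fin 3) (Fin 3) ℝ} :
    IsLeftInvariant g ↔
      ∀ p q : Fin 3 → ℝ, (boost (p 2))ᵀ * g (mul p q) * boost (p 2) = g q := by
  have hform : ∀ (A G : Matrix (Fin 3) (Fin 3) ℝ) (v w : Fin 3 → ℝ),
      (A *ᵥ v) ⬝ᵥ (G *ᵥ (A *ᵥ w)) = v ⬝ᵥ ((Aᵀ * G * A) *ᵥ w) := fun A G v w => by
    rw [← Matrix.mulVec_mulVec, ← Matrix.mulVec_mulVec, Matrix.dotProduct_mulVec v,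
      Matrix.vecMul_transpose]
  simp only [IsLeftInvariant, fderiv_mul, hform]
  refine ⟨fun h p q => ?_, fun h p q v w => by rw [h]⟩
  ext i j
  simpa using h p q (Pi.single i 1) (Pi.single j 1)

theorem IsLeftInvariant.eq_of_apply_zero {g h : (Fin 3 → ℝ) → Matrix (Fin 3) (Fin 3) ℝ}
    (hg : IsLeftInvariant g) (hh : IsLeftInvariant h) (h0 : g 0 = h 0) : g = h := by
  have hval : ∀ {k : (Fin 3 → ℝ) → Matrix (Fin 3) (Fin 3) ℝ}, IsLeftInvariant k → ∀ x,
      k x = (boost (-x 2))ᵀ * k 0 * boost (-x 2) := fun {k} hk x => by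
    have hx : mul x 0 = x := by rw [mul_eq_boost_mulVec_add, Matrix.mulVec_zero, zero_add]
    calc k x = (boost (x 2) * boost (-x 2))ᵀ * k x * (boost (x 2) * boost (-x 2)) := by
          rw [boost_mul_boost_neg, Matrix.transpose_one, one_mul, mul_one]
      _ = (boost (-x 2))ᵀ * ((boost (x 2))ᵀ * k (mul x 0) * boost (x 2)) * boost (-x 2) := by
          rw [hx]; simp only [Matrix.transpose_mul, mul_assoc]
      _ = _ := by rw [isLeftInvariant_iff.1 hk x 0]
  funext x
  rw [hval hg, hval hh, h0]

end LeftInvariance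

section NullCoframe

/-- The left-invariant coframe `e^θ (dx - dy) + a dθ`, `e^{-θ} (dx + dy) + b dθ`, `dθ`. Its first
two members are null covectors of the Minkowski plane for `a = b = 0`. -/
noncomputable def coframe (a b : ℝ) (x : Fin 3 → ℝ) : Matrix (Fin 3) (Fin 3) ℝ :=
  !![Real.exp (x 2), -Real.exp (x 2), a; Real.exp (-x 2), Real.exp (-x 2), b; 0, 0, 1]

/-- The frame dual to `coframe a b`, in columns. -/
noncomputable def frame (a b : ℝ) (x : Fin 3 → ℝ) : Matrix (Fin 3) (Fin 3) ℝ :=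
  !![Real.exp (-x 2) / 2, Real.exp (x 2) / 2, -(a * Real.exp (-x 2) + b * Real.exp (x 2)) / 2;
    -Real.exp (-x 2) / 2, Real.exp (x 2) / 2, (a * Real.exp (-x 2) - b * Real.exp (x 2)) / 2;
    0, 0, 1]

/-- The components of the derivative of `coframe a b` in that coframe. -/
def coframeDeriv (a b : ℝ) : Fin 3 → Matrix (Fin 3) (Fin 3) ℝ :=
  ![0, 0, !![1, 0, -a; 0, -1, b; 0, 0, 0]]

/-- The change from `coframe 0 0` to `coframe a b`. -/
def shear (a b : ℝ) : Matrix (Fin 3) (Fin 3) ℝ :=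
  !![1, 0, a; 0, 1, b; 0, 0, 1]

variable (a b : ℝ)

theorem shear_mul_coframe (x : Fin 3 → ℝ) : shear a b * coframe 0 0 x = coframe a b x := by
  ext i j
  fin_cases i <;> fin_cases j <;> simp [shear, coframe, Matrix.mul_apply, Fin.sum_univ_three]

theorem det_coframe (x : Fin 3 → ℝ) : (coframe a b x).det = 2 := by
  calc (coframe a b x).det = 2 * (Real.exp (x 2) * Real.exp (-x 2)) := by
        simp [coframe, Matrix.det_fin_three]; ring
    _ = 2 := by rw [← Real.exp_add, add_neg_cancel, Real.exp_zero, mul_one]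

theorem coframe_mul_boost (p q : Fin 3 → ℝ) :
    coframe a b (mul p q) * boost (p 2) = coframe a b q := by
  have hp := Real.exp_ne_zero (p 2)
  have hmul : mul p q 2 = p 2 + q 2 := rfl
  ext i j
  fin_cases i <;> fin_cases j <;>
    simp [coframe, boost, Matrix.mul_apply, Fin.sum_univ_three, hmul, Real.cosh_eq, Real.sinh_eq,
      Real.exp_add, Real.exp_neg] <;> field_simp <;> ring

theorem isLeftInvariant_ofCoframe (A : Matrix (Fin 3) (Fin 3) ℝ) :
    IsLeftInvariant (ofCoframe (coframe a b) A) := by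
  refine isLeftInvariant_iff.2 fun p q => ?_
  calc _ = (coframe a b (mul p q) * boost (p 2))ᵀ * A * (coframe a b (mul p q) * boost (p 2)) := by
        simp only [ofCoframe, Matrix.transpose_mul, mul_assoc]
    _ = _ := by rw [coframe_mul_boost, ofCoframe]

theorem pull_coframeDeriv (x : Fin 3 → ℝ) : pull (coframe a b x) (coframeDeriv a b) =
    coframeDeriv a b := by
  funext i
  fin_cases i <;> simp [pull, Fin.sum_univ_three, coframe, coframeDeriv]

theorem hasPartials_exp_smul_add (A B C : Matrix (Fin 3) (Fin 3) ℝ) (x : Fin 3 → ℝ) :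
    HasPartials (fun y => Real.exp (y 2) • A + Real.exp (-y 2) • B + C)
      ![0, 0, Real.exp (x 2) • A - Real.exp (-x 2) • B] x := by
  intro i j
  have hcoord : HasFDerivAt (fun y : Fin 3 → ℝ => y 2)
      (ContinuousLinearMap.proj (R := ℝ) (φ := fun _ : Fin 3 => ℝ) 2) x :=
    (ContinuousLinearMap.proj (R := ℝ) (φ := fun _ : Fin 3 => ℝ) 2).hasFDerivAt
  have h := ((hcoord.exp.mul_const (A i j)).add (hcoord.neg.exp.mul_const (B i j))).add_const
    (C i j)
  refine ⟨h.differentiableAt, fun k => ?_⟩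
  simp only [pd, Matrix.add_apply, Matrix.smul_apply, smul_eq_mul]
  refine (congrArg (· (Pi.single k 1)) h.fderiv).trans ?_
  fin_cases k <;> simp [sub_eq_add_neg, mul_comm]

theorem isInvariantCoframe : IsInvariantCoframe (coframe a b) (frame a b) (coframeDeriv a b) where
  mul_frame x := by
    have := Real.exp_ne_zero (x 2)
    ext i j
    fin_cases i <;> fin_cases j <;>
      simp [coframe, frame, Matrix.mul_apply, Fin.sum_univ_three, Real.exp_neg] <;>
      field_simp <;> ring
  hasPartials_coframe x := by
    convert hasPartials_exp_smul_add !![1, -1, 0; 0, 0, 0; 0, 0, 0] !![0, 0, 0; 1, 1, 0; 0, 0, 0]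
      !![0, 0, a; 0, 0, b; 0, 0, 1] x using 1
    · funext y
      ext i j
      fin_cases i <;> fin_cases j <;> simp [coframe]
    · rw [pull_coframeDeriv]
      funext k
      ext i j
      fin_cases k <;> fin_cases i <;> fin_cases j <;>
        simp [coframe, coframeDeriv, Matrix.mul_apply, Fin.sum_univ_three]
  hasPartials_frame x := by
    convert hasPartials_exp_smul_add !![0, 1 / 2, -b / 2; 0, 1 / 2, -b / 2; 0, 0, 0]
      !![1 / 2, 0, -a / 2; -1 / 2, 0, a / 2; 0, 0, 0] !![0, 0, 0; 0, 0, 0; 0, 0, 1] x using 1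
    · funext y
      ext i j
      fin_cases i <;> fin_cases j <;> simp [frame] <;> ring
    · rw [pull_coframeDeriv]
      funext k
      ext i j
      fin_cases k <;> fin_cases i <;> fin_cases j <;>
        simp [frame, coframeDeriv] <;> ring
  flat c d := by
    fin_cases c <;> fin_cases d <;> simp [coframeDeriv, Fin.sum_univ_three]

end NullCoframe

section NormalForm

/-- Parameters of the left-invariant metrics: the coframe `coframe a b` and the Gram matrix
`gram`, in which the third covector is orthogonal to the first two. -/
@[ext]
structure MetricCoeffs where
  u : ℝ
  v : ℝ
  w : ℝ
  s : ℝ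
  a : ℝ
  b : ℝ

namespace MetricCoeffs

/-- The Gram matrix in the coframe `coframe X.a X.b`. -/
def gram (X : MetricCoeffs) : Matrix (Fin 3) (Fin 3) ℝ :=
  !![X.u, X.w, 0; X.w, X.v, 0; 0, 0, X.s]

/-- The determinant of the restriction of the Gram matrix to the translation directions. -/
def disc (X : MetricCoeffs) : ℝ := X.u * X.v - X.w ^ 2

/-- The left-invariant metric with parameters `X`. -/
noncomputable def metric (X : MetricCoeffs) : (Fin 3 → ℝ) → Matrix (Fin 3) (Fin 3) ℝ :=
  ofCoframe (coframe X.a X.b) X.gram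

/-- The parameters of a positive definite Gram matrix. -/
structure IsPos (X : MetricCoeffs) : Prop where
  u_pos : 0 < X.u
  disc_pos : 0 < X.disc
  s_pos : 0 < X.s

/-- The matrices of the Levi-Civita connection of `X.metric` in the coframe `coframe X.a X.b`. -/
noncomputable def connection (X : MetricCoeffs) : Fin 3 → Matrix (Fin 3) (Fin 3) ℝ :=
  ![!![0, 0, X.u * X.v / X.disc; 0, 0, -(X.u * X.w / X.disc); -(X.u / X.s), 0, 0],
    !![0, 0, X.v * X.w / X.disc; 0, 0, -(X.u * X.v / X.disc); 0, X.v / X.s, 0],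
    !![X.w * X.w / X.disc, X.w * X.v / X.disc, 0;
      -(X.w * X.u / X.disc), -(X.w * X.w / X.disc), 0; 0, 0, 0]]

variable {X : MetricCoeffs}

theorem IsPos.v_pos (hX : X.IsPos) : 0 < X.v := by
  have hdisc : 0 < X.u * X.v - X.w ^ 2 := hX.disc_pos
  exact pos_of_mul_pos_right (by linarith [sq_nonneg X.w] : 0 < X.u * X.v) hX.u_pos.le

theorem det_gram (X : MetricCoeffs) : X.gram.det = X.disc * X.s := by
  simp [gram, disc, Matrix.det_fin_three]; ring

theorem IsPos.det_gram_pos (hX : X.IsPos) : 0 < X.gram.det := by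
  rw [det_gram]
  exact mul_pos hX.disc_pos hX.s_pos

theorem isSymm_gram (X : MetricCoeffs) : X.gram.IsSymm := by
  ext i j
  fin_cases i <;> fin_cases j <;> rfl

theorem IsPos.posDef_gram (hX : X.IsPos) : X.gram.PosDef := by
  obtain ⟨hu, hdisc, hs⟩ := hX
  refine .of_dotProduct_mulVec_pos ?_ fun y hy => ?_
  · rw [Matrix.IsHermitian, Matrix.conjTranspose_eq_transpose_of_trivial, X.isSymm_gram.eq]
  have hform : X.u * (star y ⬝ᵥ X.gram *ᵥ y) =
      (X.u * y 0 + X.w * y 1) ^ 2 + X.disc * y 1 ^ 2 + X.u * X.s * y 2 ^ 2 := by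
    simp [gram, disc, dotProduct, Matrix.mulVec, Fin.sum_univ_three]
    ring
  refine pos_of_mul_pos_right (hform ▸ ?_) hu.le
  by_cases h2 : y 2 = 0
  · by_cases h1 : y 1 = 0
    · have h0 : y 0 ≠ 0 := fun h0 => hy (by ext i; fin_cases i <;> assumption)
      rw [h1, h2]
      simp only [mul_zero, add_zero, ne_eq, OfNat.ofNat_ne_zero, not_false_eq_true, zero_pow]
      positivity
    · positivity
  · positivity

theorem IsPos.isLeviCivita (hX : X.IsPos) :
    IsLeviCivita X.gram (coframeDeriv X.a X.b) X.connection where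
  isSymm := X.isSymm_gram
  isUnit_det := hX.det_gram_pos.ne'.isUnit
  skew b := by
    have hd := hX.disc_pos.ne'
    have hs := hX.s_pos.ne'
    ext i j
    fin_cases b <;> fin_cases i <;> fin_cases j <;>
      simp [connection, gram, Matrix.mul_apply, Fin.sum_univ_three] <;> field_simp <;>
      simp only [disc] <;> ring
  torsion_free a b c := by
    have hd := hX.disc_pos.ne'
    fin_cases a <;> fin_cases b <;> fin_cases c <;>
      simp [connection, coframeDeriv] <;> field_simp <;> simp only [disc] <;> ring

theorem IsPos.isMetric (hX : X.IsPos) : IsMetric X.metric := by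
  refine ⟨fun i j => ?_, fun x => ?_⟩
  · have hexp : ContDiff ℝ ∞ fun x : Fin 3 → ℝ => Real.exp (x 2) := by fun_prop
    have hexp_neg : ContDiff ℝ ∞ fun x : Fin 3 → ℝ => Real.exp (-x 2) := by fun_prop
    have hcoframe : ∀ i j, ContDiff ℝ ∞ fun x => coframe X.a X.b x i j := fun i j => by
      fin_cases i <;> fin_cases j
      exacts [hexp, hexp.neg, contDiff_const, hexp_neg, hexp_neg, contDiff_const, contDiff_const,
        contDiff_const, contDiff_const]
    simp only [metric, ofCoframe, Matrix.mul_apply, Matrix.transpose_apply]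
    fun_prop
  · rw [metric, ofCoframe, ← Matrix.conjTranspose_eq_transpose_of_trivial]
    exact hX.posDef_gram.conjTranspose_mul_mul_same
      (Matrix.mulVec_injective_of_isUnit ((Matrix.isUnit_iff_isUnit_det _).2
        ((isInvariantCoframe X.a X.b).isUnit_det x)))

theorem isLeftInvariant_metric (X : MetricCoeffs) : IsLeftInvariant X.metric :=
  isLeftInvariant_ofCoframe X.a X.b X.gram

theorem IsPos.frameRicci_connection (hX : X.IsPos) : frameRicci X.connection =
    (2 / (X.s * X.disc)) • !![X.u * X.w ^ 2, X.u * X.v * X.w, 0; X.u * X.v * X.w, X.v * X.w ^ 2, 0;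
      0, 0, -(X.u * X.v * X.s)] := by
  have hd := hX.disc_pos.ne'
  have hs := hX.s_pos.ne'
  ext i j
  simp only [frameRicci, frameCurvature, Matrix.of_apply, Matrix.sub_apply, Matrix.mul_apply,
    Fin.sum_univ_three]
  fin_cases i <;> fin_cases j <;> simp [connection] <;> field_simp <;>
    (try simp only [disc]) <;> ring

theorem IsPos.frameCovRicci_connection (hX : X.IsPos) : frameCovRicci X.connection =
    (2 / (X.s * X.disc)) • ![
      -(X.u * X.v) • !![0, 0, X.u; 0, 0, X.w; X.u, X.w, 0],
      (X.u * X.v) • !![0, 0, X.w; 0, 0, X.v; X.w, X.v, 0],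
      (2 * X.w ^ 2) • !![X.u, 0, 0; 0, -X.v, 0; 0, 0, 0]] := by
  have hd := hX.disc_pos.ne'
  have hs := hX.s_pos.ne'
  funext b
  ext i j
  rw [frameCovRicci, hX.frameRicci_connection]
  fin_cases b <;> fin_cases i <;> fin_cases j <;>
    simp [connection, Matrix.mul_apply, Fin.sum_univ_three] <;>
      field_simp <;> simp only [disc] <;> ring

theorem IsPos.curl_frameCovRicci_connection (hX : X.IsPos) :
    curl (frameCovRicci X.connection) = (2 / (X.s * X.disc)) •
      !![X.u * X.v * X.w, X.v * (X.u * X.v + 2 * X.w ^ 2), 0;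
        X.u * (X.u * X.v + 2 * X.w ^ 2), X.u * X.v * X.w, 0; 0, 0, -(2 * (X.u * X.v * X.w))] := by
  rw [hX.frameCovRicci_connection]
  ext i j
  fin_cases i <;> fin_cases j <;>
    simp [curl, etaMatrix, eta, Matrix.mul_apply, Fin.sum_univ_three] <;> ring

theorem IsPos.inv_gram (hX : X.IsPos) : X.gram⁻¹ =
    !![X.v / X.disc, -(X.w / X.disc), 0; -(X.w / X.disc), X.u / X.disc, 0; 0, 0, X.s⁻¹] := by
  have hd := hX.disc_pos.ne'
  have hs := hX.s_pos.ne'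
  refine Matrix.inv_eq_right_inv ?_
  ext i j
  fin_cases i <;> fin_cases j <;> simp [gram, Matrix.mul_apply, Fin.sum_univ_three] <;>
    field_simp <;> simp only [disc] <;> ring

/-- The density of `|C₂| dμ` with respect to the coordinate volume, a constant function for the
left-invariant metric with parameters `X`. -/
noncomputable def cottonDensity (X : MetricCoeffs) : ℝ :=
  √(32 * (X.u * X.v) * (12 * X.w ^ 4 + 9 * X.w ^ 2 * X.disc + X.disc ^ 2) / (X.disc * X.s) ^ 2)

theorem IsPos.cottonYorkL1_metric (hX : X.IsPos) (K : Set (Fin 3 → ℝ)) :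
    cottonYorkL1 X.metric K = volume.real K * X.cottonDensity := by
  have hd := hX.disc_pos.ne'
  have hs := hX.s_pos.ne'
  have hdensity : ∀ x,
      cottonYorkNorm X.metric x * √(X.metric x).det = X.cottonDensity := fun x => by
    rw [metric, (isInvariantCoframe X.a X.b).cottonYorkNorm_mul_sqrt_det hX.isLeviCivita
      hX.det_gram_pos, det_coframe, hX.curl_frameCovRicci_connection, hX.inv_gram, cottonDensity]
    congr 1
    simp only [Matrix.trace, Matrix.diag_apply, Matrix.mul_apply, Fin.sum_univ_three]
    simp [gram]
    field_simp
    simp only [disc]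
    ring
  simp only [cottonYorkL1, hdensity, setIntegral_const, smul_eq_mul]

end MetricCoeffs

end NormalForm

theorem shear_conj (p q r z a b : ℝ) :
    (shear a b)ᵀ * !![p, r, 0; r, q, 0; 0, 0, z] * shear a b =
      !![p, r, p * a + r * b; r, q, r * a + q * b;
        p * a + r * b, r * a + q * b, p * a ^ 2 + 2 * r * a * b + q * b ^ 2 + z] := by
  ext i j
  fin_cases i <;> fin_cases j <;> simp [shear, Matrix.mul_apply, Fin.sum_univ_three] <;> ring

namespace MetricCoeffs

/-- The parameters of the left-invariant metric with Gram matrix `N` in the coframe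
`coframe 0 0`. -/
noncomputable def ofGram (N : Matrix (Fin 3) (Fin 3) ℝ) : MetricCoeffs where
  u := N 0 0
  v := N 1 1
  w := N 0 1
  s := N 2 2 - (N 1 1 * N 0 2 - N 0 1 * N 1 2) / (N 0 0 * N 1 1 - N 0 1 ^ 2) * N 0 2
    - (N 0 0 * N 1 2 - N 0 1 * N 0 2) / (N 0 0 * N 1 1 - N 0 1 ^ 2) * N 1 2
  a := (N 1 1 * N 0 2 - N 0 1 * N 1 2) / (N 0 0 * N 1 1 - N 0 1 ^ 2)
  b := (N 0 0 * N 1 2 - N 0 1 * N 0 2) / (N 0 0 * N 1 1 - N 0 1 ^ 2)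

variable {N : Matrix (Fin 3) (Fin 3) ℝ}

theorem disc_ofGram_pos (hN : N.PosDef) : 0 < (ofGram N).disc := by
  have hminor := (hN.submatrix (e := ![(0 : Fin 3), 1]) (by decide)).det_pos
  rw [Matrix.det_fin_two] at hminor
  have hsymm : N 1 0 = N 0 1 := hN.isHermitian.apply 0 1
  calc 0 < N 0 0 * N 1 1 - N 0 1 * N 1 0 := hminor
    _ = (ofGram N).disc := by rw [hsymm, ← sq]; rfl

theorem shear_conj_gram_ofGram (hN : N.PosDef) :
    (shear (ofGram N).a (ofGram N).b)ᵀ * (ofGram N).gram * shear (ofGram N).a (ofGram N).b = N := by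
  obtain ⟨D, hD⟩ : ∃ D, D = N 0 0 * N 1 1 - N 0 1 ^ 2 := ⟨_, rfl⟩
  have hd : D ≠ 0 := hD ▸ (disc_ofGram_pos hN).ne'
  have h10 : N 1 0 = N 0 1 := hN.isHermitian.apply 0 1
  have h20 : N 2 0 = N 0 2 := hN.isHermitian.apply 0 2
  have h21 : N 2 1 = N 1 2 := hN.isHermitian.apply 1 2
  rw [gram, shear_conj]
  ext i j
  fin_cases i <;> fin_cases j <;> simp [ofGram, h10, h20, h21, ← hD] <;> field_simp <;>
    rw [hD] <;> ring

theorem isPos_ofGram (hN : N.PosDef) : (ofGram N).IsPos := by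
  have hdet : (ofGram N).disc * (ofGram N).s = N.det := by
    rw [← det_gram, ← congrArg Matrix.det (shear_conj_gram_ofGram hN)]
    simp [Matrix.det_mul, shear, Matrix.det_fin_three]
  exact ⟨hN.diag_pos, disc_ofGram_pos hN,
    pos_of_mul_pos_right (hdet ▸ hN.det_pos) (disc_ofGram_pos hN).le⟩

theorem metric_eq_ofCoframe_zero (X : MetricCoeffs) :
    X.metric = ofCoframe (coframe 0 0) ((shear X.a X.b)ᵀ * X.gram * shear X.a X.b) := by
  funext x
  simp only [metric, ofCoframe, ← shear_mul_coframe X.a X.b, Matrix.transpose_mul, mul_assoc]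

end MetricCoeffs

open MetricCoeffs

/-- The Gram matrix at the identity of `g` in the coframe `coframe 0 0`. -/
noncomputable def gramAtOne (g : (Fin 3 → ℝ) → Matrix (Fin 3) (Fin 3) ℝ) :
    Matrix (Fin 3) (Fin 3) ℝ :=
  (frame 0 0 0)ᵀ * g 0 * frame 0 0 0

theorem gramAtOne_ofCoframe (a b : ℝ) (A : Matrix (Fin 3) (Fin 3) ℝ) :
    gramAtOne (ofCoframe (coframe a b) A) = (shear a b)ᵀ * A * shear a b := by
  have hEF : coframe a b 0 * frame 0 0 0 = shear a b := by
    rw [← shear_mul_coframe, mul_assoc, (isInvariantCoframe 0 0).mul_frame, mul_one]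
  simp only [← hEF, gramAtOne, ofCoframe, Matrix.transpose_mul, mul_assoc]

theorem posDef_gramAtOne {g : (Fin 3 → ℝ) → Matrix (Fin 3) (Fin 3) ℝ} (hg : (g 0).PosDef) :
    (gramAtOne g).PosDef := by
  rw [gramAtOne, ← Matrix.conjTranspose_eq_transpose_of_trivial]
  exact hg.conjTranspose_mul_mul_same (Matrix.mulVec_injective_of_isUnit
    (IsUnit.of_mul_eq_one_right _ ((isInvariantCoframe 0 0).mul_frame 0)))

theorem IsLeftInvariant.eq_metric {g : (Fin 3 → ℝ) → Matrix (Fin 3) (Fin 3) ℝ}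
    (hg : IsLeftInvariant g) (hpos : (g 0).PosDef) : g = (ofGram (gramAtOne g)).metric := by
  refine hg.eq_of_apply_zero (isLeftInvariant_metric _) ?_
  have hFE := (isInvariantCoframe 0 0).frame_mul 0
  rw [metric_eq_ofCoframe_zero, shear_conj_gram_ofGram (posDef_gramAtOne hpos)]
  symm
  calc _ = (frame 0 0 0 * coframe 0 0 0)ᵀ * g 0 * (frame 0 0 0 * coframe 0 0 0) := by
        simp only [gramAtOne, ofCoframe, Matrix.transpose_mul, mul_assoc]
    _ = g 0 := by rw [hFE, Matrix.transpose_one, one_mul, mul_one]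

section Flow

variable {I : Set ℝ} {t : ℝ}

theorem hasDerivWithinAt_conj {A : ℝ → Matrix (Fin 3) (Fin 3) ℝ} {A' : Matrix (Fin 3) (Fin 3) ℝ}
    (hA : ∀ i j, HasDerivWithinAt (fun s => A s i j) (A' i j) I t) (B : Matrix (Fin 3) (Fin 3) ℝ)
    (i j : Fin 3) : HasDerivWithinAt (fun s => (Bᵀ * A s * B) i j) ((Bᵀ * A' * B) i j) I t := by
  simp only [Matrix.mul_apply, Matrix.transpose_apply]
  exact .fun_sum fun k _ => (HasDerivWithinAt.fun_sum fun l _ => (hA l k).const_mul _).mul_const _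

namespace MetricCoeffs

/-- The Ricci flow equation for the metrics `(X t).metric` in a fixed coframe `coframe a b`. -/
structure IsFlow (I : Set ℝ) (a b : ℝ) (X : ℝ → MetricCoeffs) : Prop where
  isPos : ∀ t ∈ I, (X t).IsPos
  a_eq : ∀ t ∈ I, (X t).a = a
  b_eq : ∀ t ∈ I, (X t).b = b
  hasDerivWithinAt_u : ∀ t ∈ I, HasDerivWithinAt (fun r => (X r).u)
    (-(4 * (X t).u * (X t).w ^ 2 / ((X t).s * (X t).disc))) I t
  hasDerivWithinAt_v : ∀ t ∈ I, HasDerivWithinAt (fun r => (X r).v)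
    (-(4 * (X t).v * (X t).w ^ 2 / ((X t).s * (X t).disc))) I t
  hasDerivWithinAt_w : ∀ t ∈ I, HasDerivWithinAt (fun r => (X r).w)
    (-(4 * (X t).u * (X t).v * (X t).w / ((X t).s * (X t).disc))) I t
  hasDerivWithinAt_s : ∀ t ∈ I, HasDerivWithinAt (fun r => (X r).s)
    (4 * (X t).u * (X t).v / (X t).disc) I t

variable {a b : ℝ} {X : ℝ → MetricCoeffs}

theorem IsPos.neg_two_smul_frameRicci {X : MetricCoeffs} (hX : X.IsPos) :
    (-2 : ℝ) • frameRicci X.connection =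
      !![-(4 * X.u * X.w ^ 2 / (X.s * X.disc)), -(4 * X.u * X.v * X.w / (X.s * X.disc)), 0;
        -(4 * X.u * X.v * X.w / (X.s * X.disc)), -(4 * X.v * X.w ^ 2 / (X.s * X.disc)), 0;
        0, 0, 4 * X.u * X.v / X.disc] := by
  have hs := hX.s_pos.ne'
  rw [hX.frameRicci_connection]
  ext i j
  fin_cases i <;> fin_cases j <;> simp <;> field_simp <;> ring

theorem IsPos.neg_two_mul_ricci_metric {X : MetricCoeffs} (hX : X.IsPos) (x : Fin 3 → ℝ)
    (i j : Fin 3) :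
    -2 * ricci X.metric i j x =
      ofCoframe (coframe X.a X.b) ((-2 : ℝ) • frameRicci X.connection) x i j := by
  have hricci : ricci X.metric i j x = _ :=
    congrFun ((isInvariantCoframe X.a X.b).ricci_ofCoframe hX.isLeviCivita i j) x
  rw [hricci, ofCoframe, ofCoframe, Matrix.mul_smul, Matrix.smul_mul, Matrix.smul_apply,
    smul_eq_mul]

theorem IsFlow.hasDerivWithinAt_gram (hX : IsFlow I a b X) (ht : t ∈ I) (i j : Fin 3) :
    HasDerivWithinAt (fun r => (X r).gram i j)
      (((-2 : ℝ) • frameRicci (X t).connection) i j) I t := by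
  rw [(hX.isPos t ht).neg_two_smul_frameRicci]
  fin_cases i <;> fin_cases j
  exacts [hX.hasDerivWithinAt_u t ht, hX.hasDerivWithinAt_w t ht, hasDerivWithinAt_const ..,
    hX.hasDerivWithinAt_w t ht, hX.hasDerivWithinAt_v t ht, hasDerivWithinAt_const ..,
    hasDerivWithinAt_const .., hasDerivWithinAt_const .., hX.hasDerivWithinAt_s t ht]

theorem IsFlow.isRicciFlowOn (hX : IsFlow I a b X) : IsRicciFlowOn I fun t => (X t).metric := by
  refine ⟨fun t ht => (hX.isPos t ht).isMetric, fun t ht x i j => ?_⟩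
  have hmetric : ∀ s ∈ I, (X s).metric x i j =
      ((coframe a b x)ᵀ * (X s).gram * coframe a b x) i j := fun s hs => by
    rw [metric, ofCoframe, hX.a_eq s hs, hX.b_eq s hs]
  refine ((hasDerivWithinAt_conj (hX.hasDerivWithinAt_gram ht) (coframe a b x) i j).congr
    hmetric (hmetric t ht)).congr_deriv ?_
  rw [(hX.isPos t ht).neg_two_mul_ricci_metric, ofCoframe, hX.a_eq t ht, hX.b_eq t ht]

theorem hasDerivWithinAt_ofGram {N : ℝ → Matrix (Fin 3) (Fin 3) ℝ} {p q r z : ℝ}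
    (hpos : (N t).PosDef)
    (hN : ∀ i j, HasDerivWithinAt (fun s => N s i j) (((shear (ofGram (N t)).a (ofGram (N t)).b)ᵀ *
      !![p, r, 0; r, q, 0; 0, 0, z] * shear (ofGram (N t)).a (ofGram (N t)).b) i j) I t) :
    HasDerivWithinAt (fun s => (ofGram (N s)).a) 0 I t ∧
    HasDerivWithinAt (fun s => (ofGram (N s)).b) 0 I t ∧
    HasDerivWithinAt (fun s => (ofGram (N s)).u) p I t ∧
    HasDerivWithinAt (fun s => (ofGram (N s)).v) q I t ∧
    HasDerivWithinAt (fun s => (ofGram (N s)).w) r I t ∧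
    HasDerivWithinAt (fun s => (ofGram (N s)).s) z I t := by
  have hd : N t 0 0 * N t 1 1 - N t 0 1 ^ 2 ≠ 0 := (disc_ofGram_pos hpos).ne'
  have hconj := shear_conj_gram_ofGram hpos
  rw [gram, shear_conj] at hconj
  rw [shear_conj] at hN
  obtain ⟨a, ha⟩ : ∃ a, a = (ofGram (N t)).a := ⟨_, rfl⟩
  obtain ⟨b, hb⟩ : ∃ b, b = (ofGram (N t)).b := ⟨_, rfl⟩
  rw [← ha, ← hb] at hN hconj
  have h02 : N t 0 2 = N t 0 0 * a + N t 0 1 * b := (congrFun₂ hconj 0 2).symm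
  have h12 : N t 1 2 = N t 0 1 * a + N t 1 1 * b := (congrFun₂ hconj 1 2).symm
  have hu : HasDerivWithinAt (fun s => N s 0 0) p I t := hN 0 0
  have hv : HasDerivWithinAt (fun s => N s 1 1) q I t := hN 1 1
  have hw : HasDerivWithinAt (fun s => N s 0 1) r I t := hN 0 1
  have hx : HasDerivWithinAt (fun s => N s 0 2) (p * a + r * b) I t := hN 0 2
  have hy : HasDerivWithinAt (fun s => N s 1 2) (r * a + q * b) I t := hN 1 2
  have hz : HasDerivWithinAt (fun s => N s 2 2)
    (p * a ^ 2 + 2 * r * a * b + q * b ^ 2 + z) I t := hN 2 2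
  have hdisc := (hu.mul hv).sub (hw.pow 2)
  have hda : HasDerivWithinAt (fun s => (ofGram (N s)).a) 0 I t := by
    refine (((hv.mul hx).sub (hw.mul hy)).div hdisc hd).congr_deriv ?_
    simp only [Pi.sub_apply, Pi.mul_apply, Pi.pow_apply, div_eq_zero_iff]
    left
    rw [h02, h12]
    push_cast
    ring
  have hdb : HasDerivWithinAt (fun s => (ofGram (N s)).b) 0 I t := by
    refine (((hu.mul hy).sub (hw.mul hx)).div hdisc hd).congr_deriv ?_
    simp only [Pi.sub_apply, Pi.mul_apply, Pi.pow_apply, div_eq_zero_iff]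
    left
    rw [h02, h12]
    push_cast
    ring
  refine ⟨hda, hdb, hu, hv, hw, ((hz.sub (hda.mul hx)).sub (hdb.mul hy)).congr_deriv ?_⟩
  rw [← ha, ← hb]
  ring

theorem gramAtOne_neg_two_mul_ricci {X : MetricCoeffs} (hX : X.IsPos) :
    gramAtOne (fun x => Matrix.of fun i j => -2 * ricci X.metric i j x) =
      (shear X.a X.b)ᵀ * ((-2 : ℝ) • frameRicci X.connection) * shear X.a X.b := by
  rw [← gramAtOne_ofCoframe]
  congr 1
  funext x
  ext i j
  exact hX.neg_two_mul_ricci_metric x i j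

theorem isFlow_of_isRicciFlowOn {h : ℝ → (Fin 3 → ℝ) → Matrix (Fin 3) (Fin 3) ℝ}
    (hI : Convex ℝ I) (hh : IsRicciFlowOn I h) (hinv : ∀ t ∈ I, IsLeftInvariant (h t))
    (ht : t ∈ I) : IsFlow I (ofGram (gramAtOne (h t))).a (ofGram (gramAtOne (h t))).b
      fun r => ofGram (gramAtOne (h r)) := by
  have hgram : ∀ r ∈ I, (gramAtOne (h r)).PosDef := fun r hr => posDef_gramAtOne ((hh.1 r hr).2 0)
  have hpos := fun r hr => isPos_ofGram (hgram r hr)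
  have hderiv := fun r hr => hasDerivWithinAt_ofGram (hgram r hr) (I := I)
    (N := fun q => gramAtOne (h q)) fun i j => by
      rw [← (hpos r hr).neg_two_smul_frameRicci, ← gramAtOne_neg_two_mul_ricci (hpos r hr),
        ← (hinv r hr).eq_metric ((hh.1 r hr).2 0)]
      exact hasDerivWithinAt_conj (hh.2 r hr 0) _ i j
  exact {
    isPos := hpos
    a_eq := fun r hr => eq_of_hasDerivWithinAt_zero hI (fun q hq => (hderiv q hq).1) ht hr
    b_eq := fun r hr => eq_of_hasDerivWithinAt_zero hI (fun q hq => (hderiv q hq).2.1) ht hr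
    hasDerivWithinAt_u := fun r hr => (hderiv r hr).2.2.1
    hasDerivWithinAt_v := fun r hr => (hderiv r hr).2.2.2.1
    hasDerivWithinAt_w := fun r hr => (hderiv r hr).2.2.2.2.1
    hasDerivWithinAt_s := fun r hr => (hderiv r hr).2.2.2.2.2 }

end MetricCoeffs

end Flow

namespace MetricCoeffs

section FlowCurve

/-- The common factor of `u` and `v` along the flow curve of `X`. -/
noncomputable def scale (X : MetricCoeffs) (s : ℝ) : ℝ :=
  √((X.disc + (X.w * X.s / s) ^ 2) / (X.u * X.v))

/-- The trajectory of `X` under the Ricci flow, parametrized by the coefficient `s`: the flow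
preserves `disc`, `w * s`, `u / v` and the coframe. -/
noncomputable def flowCurve (X : MetricCoeffs) (s : ℝ) : MetricCoeffs where
  u := X.scale s * X.u
  v := X.scale s * X.v
  w := X.w * X.s / s
  s := s
  a := X.a
  b := X.b

variable {X Y : MetricCoeffs} {s : ℝ}

theorem IsPos.scale_arg_pos (hX : X.IsPos) (s : ℝ) :
    0 < (X.disc + (X.w * X.s / s) ^ 2) / (X.u * X.v) := by
  have := hX.u_pos
  have := hX.v_pos
  have := hX.disc_pos
  positivity

theorem IsPos.scale_pos (hX : X.IsPos) (s : ℝ) : 0 < X.scale s :=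
  Real.sqrt_pos.2 (hX.scale_arg_pos s)

theorem IsPos.flowCurve_u_mul_v (hX : X.IsPos) (s : ℝ) :
    (X.flowCurve s).u * (X.flowCurve s).v = X.disc + (X.w * X.s / s) ^ 2 := by
  have hu := hX.u_pos.ne'
  have hv := hX.v_pos.ne'
  calc X.scale s * X.u * (X.scale s * X.v) = X.scale s ^ 2 * (X.u * X.v) := by ring
    _ = _ := by rw [scale, Real.sq_sqrt (hX.scale_arg_pos s).le]; field_simp

theorem IsPos.disc_flowCurve (hX : X.IsPos) (s : ℝ) : (X.flowCurve s).disc = X.disc := by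
  rw [disc, hX.flowCurve_u_mul_v]
  exact add_sub_cancel_right _ _

theorem IsPos.flowCurve (hX : X.IsPos) (hs : 0 < s) : (X.flowCurve s).IsPos where
  u_pos := mul_pos (hX.scale_pos s) hX.u_pos
  disc_pos := hX.disc_flowCurve s ▸ hX.disc_pos
  s_pos := hs

theorem IsPos.eq_flowCurve (hX : X.IsPos) (hY : Y.IsPos) (hdisc : Y.disc = X.disc)
    (hws : Y.w * Y.s = X.w * X.s) (huv : Y.u / Y.v = X.u / X.v) (ha : Y.a = X.a)
    (hb : Y.b = X.b) : Y = X.flowCurve Y.s := by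
  have hu := hX.u_pos
  have hv := hX.v_pos
  have hw : Y.w = X.w * X.s / Y.s := eq_div_of_mul_eq hY.s_pos.ne' hws
  have hvY : Y.v * X.u = Y.u * X.v := by
    have := hY.v_pos.ne'
    field_simp at huv
    linarith
  have hscale : X.scale Y.s = Y.u / X.u := by
    rw [scale, Real.sqrt_eq_iff_eq_sq (hX.scale_arg_pos Y.s).le (div_pos hY.u_pos hu).le, ← hw,
      ← hdisc, disc, sub_add_cancel]
    field_simp
    linear_combination Y.u * hvY
  ext
  · change Y.u = X.scale Y.s * X.u
    rw [hscale, div_mul_cancel₀ _ hu.ne']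
  · change Y.v = X.scale Y.s * X.v
    rw [hscale]
    field_simp
    exact hvY
  exacts [hw, rfl, ha, hb]

theorem IsPos.hasDerivAt_scale (hX : X.IsPos) (hs : 0 < s) : HasDerivAt X.scale
    (-((X.w * X.s / s) ^ 2 / (s * (X.u * X.v) * X.scale s))) s := by
  have hs₀ := hs.ne'
  have hρ := (hX.scale_pos s).ne'
  have hu := hX.u_pos.ne'
  have hv := hX.v_pos.ne'
  have hw : HasDerivAt (fun r => X.w * X.s / r) (-(X.w * X.s) / s ^ 2) s := by
    simpa using (hasDerivAt_const s (X.w * X.s)).fun_div (hasDerivAt_id s) hs.ne'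
  refine ((((hw.fun_pow 2).const_add X.disc).div_const (X.u * X.v)).sqrt
    (hX.scale_arg_pos s).ne').congr_deriv ?_
  rw [← scale, Nat.cast_ofNat, Nat.add_one_sub_one, pow_one]
  field_simp

/-- The time derivative of `s` along the Ricci flow, as a function of the flow invariants of `X`
and of `s`. -/
noncomputable def speed (X : MetricCoeffs) (s : ℝ) : ℝ :=
  4 + 4 * (X.w * X.s / s) ^ 2 / X.disc

theorem IsPos.speed_eq (hX : X.IsPos) (s : ℝ) : X.speed s =
    4 * (X.flowCurve s).u * (X.flowCurve s).v / (X.flowCurve s).disc := by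
  have hd := hX.disc_pos.ne'
  rw [mul_assoc, hX.flowCurve_u_mul_v, hX.disc_flowCurve, speed]
  field_simp

theorem IsPos.isFlow_flowCurve {I : Set ℝ} {σ : ℝ → ℝ} (hX : X.IsPos) (hpos : ∀ t ∈ I, 0 < σ t)
    (hσ : ∀ t ∈ I, HasDerivWithinAt σ (X.speed (σ t)) I t) :
    IsFlow I X.a X.b fun t => X.flowCurve (σ t) := by
  have hu := hX.u_pos.ne'
  have hv := hX.v_pos.ne'
  have hd := hX.disc_pos.ne'
  have hspeed : ∀ t,
      X.speed (σ t) * X.disc = 4 * (X.scale (σ t) * X.u) * (X.scale (σ t) * X.v) := fun t => by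
    rw [hX.speed_eq, hX.disc_flowCurve, div_mul_cancel₀ _ hd]
    rfl
  have hscale : ∀ t ∈ I, HasDerivWithinAt (fun r => X.scale (σ r))
      (-(4 * X.scale (σ t) * (X.w * X.s / σ t) ^ 2 / (σ t * X.disc))) I t := fun t ht => by
    have hs := (hpos t ht).ne'
    have hρ := (hX.scale_pos (σ t)).ne'
    refine ((hX.hasDerivAt_scale (hpos t ht)).comp_hasDerivWithinAt t (hσ t ht)).congr_deriv ?_
    field_simp
    linear_combination -X.w ^ 2 * X.s ^ 2 * hspeed t
  refine ⟨fun t ht => hX.flowCurve (hpos t ht), fun _ _ => rfl, fun _ _ => rfl,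
    fun t ht => ?_, fun t ht => ?_, fun t ht => ?_, fun t ht => ?_⟩
  · refine ((hscale t ht).mul_const X.u).congr_deriv ?_
    rw [hX.disc_flowCurve]
    simp only [MetricCoeffs.flowCurve]
    ring
  · refine ((hscale t ht).mul_const X.v).congr_deriv ?_
    rw [hX.disc_flowCurve]
    simp only [MetricCoeffs.flowCurve]
    ring
  · have hs := (hpos t ht).ne'
    refine ((hasDerivWithinAt_const t I (X.w * X.s)).fun_div (hσ t ht) hs).congr_deriv ?_
    rw [hX.disc_flowCurve]
    simp only [MetricCoeffs.flowCurve]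
    field_simp
    linear_combination -(X.w * X.s) * hspeed t
  · exact (hσ t ht).congr_deriv (hX.speed_eq _)

end FlowCurve

section Uniqueness

variable {I : Set ℝ} {a b t₀ t : ℝ} {X : ℝ → MetricCoeffs}

theorem IsFlow.disc_eq (hX : IsFlow I a b X) (hI : Convex ℝ I) (ht₀ : t₀ ∈ I) (ht : t ∈ I) :
    (X t).disc = (X t₀).disc := by
  refine eq_of_hasDerivWithinAt_zero (f := fun r => (X r).disc) hI (fun r hr => ?_) ht₀ ht
  refine (((hX.hasDerivWithinAt_u r hr).mul (hX.hasDerivWithinAt_v r hr)).sub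
    ((hX.hasDerivWithinAt_w r hr).pow 2)).congr_deriv ?_
  push_cast
  ring

theorem IsFlow.w_mul_s_eq (hX : IsFlow I a b X) (hI : Convex ℝ I) (ht₀ : t₀ ∈ I) (ht : t ∈ I) :
    (X t).w * (X t).s = (X t₀).w * (X t₀).s := by
  refine eq_of_hasDerivWithinAt_zero (f := fun r => (X r).w * (X r).s) hI (fun r hr => ?_) ht₀ ht
  have hs := (hX.isPos r hr).s_pos.ne'
  refine ((hX.hasDerivWithinAt_w r hr).mul (hX.hasDerivWithinAt_s r hr)).congr_deriv ?_
  field_simp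
  ring

theorem IsFlow.u_div_v_eq (hX : IsFlow I a b X) (hI : Convex ℝ I) (ht₀ : t₀ ∈ I) (ht : t ∈ I) :
    (X t).u / (X t).v = (X t₀).u / (X t₀).v := by
  refine eq_of_hasDerivWithinAt_zero (f := fun r => (X r).u / (X r).v) hI (fun r hr => ?_) ht₀ ht
  refine ((hX.hasDerivWithinAt_u r hr).div (hX.hasDerivWithinAt_v r hr)
    (hX.isPos r hr).v_pos.ne').congr_deriv ?_
  ring

theorem IsFlow.eq_flowCurve (hX : IsFlow I a b X) (hI : Convex ℝ I) (ht₀ : t₀ ∈ I) (ht : t ∈ I) :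
    X t = (X t₀).flowCurve (X t).s :=
  (hX.isPos t₀ ht₀).eq_flowCurve (hX.isPos t ht) (hX.disc_eq hI ht₀ ht) (hX.w_mul_s_eq hI ht₀ ht)
    (hX.u_div_v_eq hI ht₀ ht) ((hX.a_eq t ht).trans (hX.a_eq t₀ ht₀).symm)
    ((hX.b_eq t ht).trans (hX.b_eq t₀ ht₀).symm)

theorem IsFlow.hasDerivWithinAt_s_speed (hX : IsFlow I a b X) (hI : Convex ℝ I) (ht₀ : t₀ ∈ I)
    (ht : t ∈ I) : HasDerivWithinAt (fun r => (X r).s) ((X t₀).speed (X t).s) I t := by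
  rw [(hX.isPos t₀ ht₀).speed_eq, ← hX.eq_flowCurve hI ht₀ ht]
  exact hX.hasDerivWithinAt_s t ht

theorem IsFlow.monotoneOn_s (hX : IsFlow I a b X) (hI : Convex ℝ I) :
    MonotoneOn (fun t => (X t).s) I := by
  refine monotoneOn_of_hasDerivWithinAt_nonneg hI
    (fun t ht => (hX.hasDerivWithinAt_s t ht).continuousWithinAt)
    (fun t ht => (hX.hasDerivWithinAt_s t (interior_subset ht)).mono interior_subset)
    fun t ht => ?_
  have hpos := hX.isPos t (interior_subset ht)
  have := hpos.u_pos
  have := hpos.v_pos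
  have := hpos.disc_pos
  positivity

end Uniqueness

section Existence

variable {X : MetricCoeffs}

theorem IsPos.exists_isFlow (hX : X.IsPos) : ∃ σ : ℝ ≃o ℝ, σ 0 = X.s ∧
    (IsFlow (Ici 0) X.a X.b fun t => X.flowCurve (σ t)) ∧
    ∀ {T a b : ℝ} {Y : ℝ → MetricCoeffs}, IsFlow (Ico 0 T) a b Y → Y 0 = X →
      ∀ t ∈ Ico 0 T, Y t = X.flowCurve (σ t) := by
  have hd := hX.disc_pos
  -- The speed is unbounded near `s = 0`, but `s` increases along the flow, so the values of
  -- `speed` below `X.s` are immaterial.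
  have hmax : ∀ y, 0 < max y X.s := fun y => lt_max_of_lt_right hX.s_pos
  have hcont : Continuous fun y => X.speed (max y X.s) := by
    unfold speed
    fun_prop (disch := exact fun y => (hmax y).ne')
  have hpos : ∀ y, 0 < X.speed y := fun y => by unfold speed; positivity
  have hle : ∀ y, X.speed (max y X.s) ≤ X.speed X.s := fun y => by
    have := hX.s_pos
    simp only [speed, div_pow _ (max y X.s), div_pow _ X.s]
    gcongr
    exact le_max_right y X.s
  obtain ⟨σ, hσ₀, hσ, hσ_symm⟩ := exists_orderIso_hasDerivAt hcont (fun y => hpos _) hle X.s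
  have hs_le : ∀ t ∈ Ici (0 : ℝ), X.s ≤ σ t := fun t ht => hσ₀ ▸ σ.monotone ht
  refine ⟨σ, hσ₀, hX.isFlow_flowCurve (fun t ht => hX.s_pos.trans_le (hs_le t ht)) fun t ht => ?_,
    fun {T a b Y} hY hY₀ t ht => ?_⟩
  · simpa only [max_eq_left (hs_le t ht)] using (hσ t).hasDerivWithinAt
  · have h0 : (0 : ℝ) ∈ Ico 0 T := ⟨le_rfl, ht.1.trans_lt ht.2⟩
    have hY_le : ∀ r ∈ Ico 0 T, X.s ≤ (Y r).s := fun r hr =>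
      hY₀ ▸ hY.monotoneOn_s (convex_Ico 0 T) h0 hr hr.1
    have hs : (Y t).s = σ t := by
      refine eq_orderIso_of_hasDerivWithinAt (f := fun y => X.speed (max y X.s))
        (y := fun r => (Y r).s) (fun _ _ => (hpos _).ne') hσ_symm (convex_Ico 0 T)
        (fun r hr => ?_) h0 (by rw [hY₀, hσ₀]) ht
      simp only [max_eq_left (hY_le r hr)]
      rw [← hY₀]
      exact hY.hasDerivWithinAt_s_speed (convex_Ico 0 T) h0 hr
    rw [hY.eq_flowCurve (convex_Ico 0 T) h0 ht, hY₀, hs]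

end Existence

section Monotonicity

variable {X : MetricCoeffs}

theorem IsPos.cottonDensity_flowCurve (hX : X.IsPos) (s : ℝ) : (X.flowCurve s).cottonDensity =
    √(32 * (X.disc + (X.w * X.s / s) ^ 2) * (12 * ((X.w * X.s / s) ^ 2) ^ 2 +
      9 * (X.w * X.s / s) ^ 2 * X.disc + X.disc ^ 2) / (X.disc * s) ^ 2) := by
  rw [cottonDensity, hX.flowCurve_u_mul_v, hX.disc_flowCurve, ← pow_mul]
  rfl

theorem IsPos.strictAntiOn_cottonDensity (hX : X.IsPos) :
    StrictAntiOn (fun s => (X.flowCurve s).cottonDensity) (Ioi 0) := by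
  intro s hs r hr hsr
  have hd := hX.disc_pos
  simp only [mem_Ioi] at hs hr
  have hw : (X.w * X.s / r) ^ 2 ≤ (X.w * X.s / s) ^ 2 := by
    rw [div_pow, div_pow]
    gcongr
  have hw₀ : 0 ≤ (X.w * X.s / r) ^ 2 := sq_nonneg _
  simp only [hX.cottonDensity_flowCurve]
  generalize (X.w * X.s / r) ^ 2 = p, (X.w * X.s / s) ^ 2 = q at hw hw₀
  have hq₀ := hw₀.trans hw
  refine Real.sqrt_lt_sqrt (by positivity)
    (div_lt_div₀' ?_ ?_ (by positivity) (by positivity)) <;> gcongr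

theorem IsPos.tendsto_cottonDensity (hX : X.IsPos) :
    Tendsto (fun s => (X.flowCurve s).cottonDensity) atTop (𝓝 0) := by
  have hw : Tendsto (fun s => X.w * X.s / s) atTop (𝓝 0) := tendsto_const_nhds.div_atTop tendsto_id
  have hnum := ((hw.pow 2).const_add X.disc |>.const_mul 32).mul
    (((((hw.pow 2).pow 2).const_mul 12).add (((hw.pow 2).const_mul 9).mul_const X.disc)).add_const
      (X.disc ^ 2))
  have hden : Tendsto (fun s => (X.disc * s) ^ 2) atTop atTop :=
    (tendsto_pow_atTop two_ne_zero).comp (tendsto_id.const_mul_atTop hX.disc_pos)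
  simpa only [hX.cottonDensity_flowCurve, Real.sqrt_zero] using (hnum.div_atTop hden).sqrt

end Monotonicity

end MetricCoeffs

end IsomMinkowski

open IsomMinkowski MetricCoeffs in
theorem theorem3p10_general (g₀ : (Fin 3 → ℝ) → Matrix (Fin 3) (Fin 3) ℝ)
    (hpos : (g₀ 0).PosDef) (hinv : IsomMinkowski.IsLeftInvariant g₀) :
    ∃ g : ℝ → (Fin 3 → ℝ) → Matrix (Fin 3) (Fin 3) ℝ,
      IsomMinkowski.IsInvariantRicciFlow (Ici 0) g₀ g ∧
      (∀ (T : ℝ) (h : ℝ → (Fin 3 → ℝ) → Matrix (Fin 3) (Fin 3) ℝ),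
        IsomMinkowski.IsInvariantRicciFlow (Ico 0 T) g₀ h → ∀ t ∈ Ico 0 T, h t = g t) ∧
      ∀ K : Set (Fin 3 → ℝ), volume K ≠ ⊤ →
        Tendsto (fun t => Riem3.cottonYorkL1 (g t) K) atTop (𝓝 0) ∧
        (volume K ≠ 0 → StrictAntiOn (fun t => Riem3.cottonYorkL1 (g t) K) (Ici 0)) := by
  have hX : (ofGram (gramAtOne g₀)).IsPos := isPos_ofGram (posDef_gramAtOne hpos)
  have hg₀ : g₀ = (ofGram (gramAtOne g₀)).metric := hinv.eq_metric hpos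
  generalize hXg₀ : ofGram (gramAtOne g₀) = X at hX hg₀
  obtain ⟨σ, hσ₀, hflow, huniq⟩ := hX.exists_isFlow
  have hcotton : ∀ K, ∀ t ∈ Ici (0 : ℝ), volume.real K * (X.flowCurve (σ t)).cottonDensity =
      Riem3.cottonYorkL1 (X.flowCurve (σ t)).metric K :=
    fun K t ht => ((hflow.isPos t ht).cottonYorkL1_metric K).symm
  refine ⟨fun t => (X.flowCurve (σ t)).metric,
    ⟨hflow.isRicciFlowOn, fun _ _ => isLeftInvariant_metric _, ?_⟩, ?_, fun K hK => ⟨?_, ?_⟩⟩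
  · beta_reduce
    rw [hσ₀, ← hX.eq_flowCurve hX rfl rfl rfl rfl rfl, ← hg₀]
  · rintro T h ⟨hh, hhinv, hh₀⟩ t ht
    have h0 : (0 : ℝ) ∈ Ico 0 T := ⟨le_rfl, ht.1.trans_lt ht.2⟩
    rw [(hhinv t ht).eq_metric ((hh.1 t ht).2 0),
      huniq (isFlow_of_isRicciFlowOn (convex_Ico 0 T) hh hhinv h0) (by rw [hh₀, hXg₀]) t ht]
  · refine Tendsto.congr' (eventually_ge_atTop 0 |>.mono (hcotton K)) ?_
    simpa using (hX.tendsto_cottonDensity.comp σ.tendsto_atTop).const_mul (volume.real K)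
  · intro hK₀
    refine StrictAntiOn.congr (fun r hr t ht hrt => ?_) (hcotton K)
    have hσpos : ∀ t ∈ Ici (0 : ℝ), σ t ∈ Ioi 0 := fun t ht => (hflow.isPos t ht).s_pos
    exact mul_lt_mul_of_pos_left (hX.strictAntiOn_cottonDensity (hσpos r hr) (hσpos t ht)
      (σ.strictMono hrt)) (ENNReal.toReal_pos hK₀ hK)

theorem theorem3p10 (g₀ : (Fin 3 → ℝ) → Matrix (Fin 3) (Fin 3) ℝ)
    (hg₀ : Riem3.IsMetric g₀) (hinv : IsomMinkowski.IsLeftInvariant g₀) :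
    ∃ g : ℝ → (Fin 3 → ℝ) → Matrix (Fin 3) (Fin 3) ℝ,
      IsomMinkowski.IsInvariantRicciFlow (Ici 0) g₀ g ∧
      (∀ (T : ℝ) (h : ℝ → (Fin 3 → ℝ) → Matrix (Fin 3) (Fin 3) ℝ),
        IsomMinkowski.IsInvariantRicciFlow (Ico 0 T) g₀ h → ∀ t ∈ Ico 0 T, h t = g t) ∧
      ∀ K : Set (Fin 3 → ℝ), IsCompact K →
        Tendsto (fun t => Riem3.cottonYorkL1 (g t) K) atTop (𝓝 0) ∧
        (volume K ≠ 0 → StrictAntiOn (fun t => Riem3.cottonYorkL1 (g t) K) (Ici 0)) := by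
  obtain ⟨g, hg, huniq, hcotton⟩ := theorem3p10_general g₀ (hg₀.2 0) hinv
  exact ⟨g, hg, huniq, fun K hK => hcotton K hK.measure_lt_top.ne⟩
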